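/- Notation. For a group $X$ write $X'=[X,X]$, $[x,y]=x^{-1}y^{-1}xy$, $x^z=z^{-1}xz$. An automorphism $\alpha$ of $X$ is an \emph{AI-automorphism} if it induces inversion on $X/X'$. A \emph{Schur cover} of a finite group $G$ is a group $H$ together with a surjective homomorphism $H\to G$ whose kernel $M$ satisfies $M\le H'\cap Z(H)$ and is isomorphic to the Schur multiplier $M(G)=H^2(G,\mathbb{C}^\times)$ (trivial action). For $n\ge 2$ let $K(X,n)=\{(x_1,\dots,x_n)\in X^n : x_1\cdots x_n\in X'\}$, and for a free presentation $G=F/N$ with $F$ free of finite rank let $\tilde K(G,n)=K(F,n)/K(N,n)^{F^n}$, where $K(N,n)^{F^n}$ is the normal closure of $K(N,n)$ in $F^n$ (up to isomorphism this does not depend on the presentation). Let $G^*$ be an isomorphic copy of $G$ via $g\mapsto g^*$, let $\nu(G)$ be the quotient of the free product $G\star G^*$ by the relations $[x,y^*]^z=[x^z,(y^z)^*]=[x,y^*]^{(z^*)}$ for all $x,y,z\in G$, and let $\tau(G)=\nu(G)/\nabla(G)$, where $\nabla(G)$ is the (normal) subgroup generated by all $[x,x^*]$, $x\in G$. Proposition.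 Let $p$ be an odd prime and let $G$ be an extra-special $p$-group, that is, a finite $p$-group with $G'=Z(G)$ of order $p$. (a) Suppose $\exp(G)=p$. If $|G|=p^3$, then $\tau(G)\cong\tilde K(G,3)$, for every free presentation of $G$ of finite rank. If $|G|=p^{2n+1}$ with $n\ge 2$, then there exists a Schur cover of $G$ that admits an AI-automorphism, but for every Schur cover $H$ of $G$, with kernel $M$ of $H\to G$, no AI-automorphism $\alpha$ of $H$ inverts the Schur multiplier, i.e. no such $\alpha$ satisfies $\alpha(m)=m^{-1}$ for all $m\in M$. (b) If $\exp(G)=p^2$, then $G$ has no AI-automorphism. -/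

import Mathlib

universe u v w

/-- A `p`-group is extra-special if its derived subgroup and its centre coincide and have
order `p`. -/
structure IsExtraSpecial (p : ℕ) (G : Type u) [Group G] : Prop where
  isPGroup : IsPGroup p G
  commutator_eq_center : commutator G = Subgroup.center G
  card_center : Nat.card (Subgroup.center G) = p

/-- An automorphism is an AI-automorphism if it induces inversion on the abelianisation. -/
def IsAI {G : Type u} [Group G] (α : G ≃* G) : Prop :=
  ∀ x : Abelianization G, α.abelianizationCongr x = x⁻¹

/-- The Schur multiplier `H²(G, ℂˣ)` of `G`, for the trivial action of `G` on `ℂˣ`, written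
multiplicatively. (The `ULift`s only adjust universe levels.) -/
abbrev SchurMultiplier (G : Type u) [Group G] : Type u :=
  Multiplicative (groupCohomology.H2
    (Rep.trivial (ULift.{u} ℤ) G (ULift.{u} (Additive ℂˣ))))

/-- `π : H → G` exhibits `H` as a Schur cover of `G`: it is surjective, and its kernel `M` lies in
`H' ∩ Z(H)` and is isomorphic to the Schur multiplier of `G`; thus `H / M ≅ G`. -/
structure IsSchurCover {H : Type v} {G : Type u} [Group H] [Group G] (π : H →* G) : Prop where
  surjective : Function.Surjective π
  ker_le_commutator : π.ker ≤ commutator H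
  ker_le_center : π.ker ≤ Subgroup.center H
  ker_iso : Nonempty (π.ker ≃* SchurMultiplier G)

/-- The map `G^n → G / G'` sending a tuple to the product of its components modulo `G'`. -/
def prodMod (G : Type u) [Group G] (n : ℕ) : (Fin n → G) →* Abelianization G where
  toFun g := ∏ i, Abelianization.of (g i)
  map_one' := by simp
  map_mul' g h := by simp [Finset.prod_mul_distrib]

/-- `K(G, n)`, as a subgroup of `G^n`. -/
def liedtkeK (G : Type u) [Group G] (n : ℕ) : Subgroup (Fin n → G) :=
  (prodMod G n).ker

/-- For `N ≤ F`, the group `K(N, n)` as a subgroup of `F^n`. -/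
def liedtkeKIn {F : Type u} [Group F] (N : Subgroup F) (n : ℕ) : Subgroup (Fin n → F) :=
  (liedtkeK N n).map (MonoidHom.piMap fun _ => N.subtype)

/-- For a free presentation `π : F → G` with kernel `N`, the group
`K̃(G, n) = K(F, n) / K(N, n)^(F^n)`, where the denominator is the normal closure of `K(N, n)`
in `F^n` (it is contained in `K(F, n)`). -/
abbrev LiedtkeKTilde {F : Type u} {G : Type v} [Group F] [Group G] (π : F →* G) (n : ℕ) :
    Type u :=
  liedtkeK F n ⧸
    (Subgroup.normalClosure (liedtkeKIn π.ker n : Set (Fin n → F))).subgroupOf (liedtkeK F n)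

/-- The commutator `[x, y] = x⁻¹ y⁻¹ x y`. -/
def comm' {G : Type u} [Group G] (x y : G) : G := x⁻¹ * y⁻¹ * x * y

/-- The conjugate `x ^ z = z⁻¹ x z`. -/
def conj' {G : Type u} [Group G] (x z : G) : G := z⁻¹ * x * z

/-- The elements `[x, y*]^z [x^z, (y^z)*]⁻¹` and `[x, y*]^(z*) [x^z, (y^z)*]⁻¹` of the free product
of `G` and `G*`, where `G*` is the second copy of `G`. -/
def nuRels (G : Type u) [Group G] : Set (Monoid.Coprod G G) :=
  {w | ∃ x y z : G,
    w = conj' (comm' (Monoid.Coprod.inl x) (Monoid.Coprod.inr y)) (Monoid.Coprod.inl z) *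
        (comm' (Monoid.Coprod.inl (conj' x z)) (Monoid.Coprod.inr (conj' y z)))⁻¹ ∨
    w = conj' (comm' (Monoid.Coprod.inl x) (Monoid.Coprod.inr y)) (Monoid.Coprod.inr z) *
        (comm' (Monoid.Coprod.inl (conj' x z)) (Monoid.Coprod.inr (conj' y z)))⁻¹}

/-- The group `ν(G)`. -/
abbrev Nu (G : Type u) [Group G] : Type u :=
  Monoid.Coprod G G ⧸ Subgroup.normalClosure (nuRels G)

/-- The canonical map `G → ν(G)`, `g ↦ g`. -/
def Nu.inl (G : Type u) [Group G] : G →* Nu G :=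
  (QuotientGroup.mk' _).comp Monoid.Coprod.inl

/-- The canonical map `G → ν(G)`, `g ↦ g*`. -/
def Nu.inr (G : Type u) [Group G] : G →* Nu G :=
  (QuotientGroup.mk' _).comp Monoid.Coprod.inr

/-- The subgroup `∇(G)` of `ν(G)` generated by all `[x, x*]`. -/
def nabla (G : Type u) [Group G] : Subgroup (Nu G) :=
  Subgroup.closure (Set.range fun x : G => comm' (Nu.inl G x) (Nu.inr G x))

theorem Nu.conj_inl {G : Type u} [Group G] (x y z : G) :
    conj' (comm' (Nu.inl G x) (Nu.inr G y)) (Nu.inl G z) =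
      comm' (Nu.inl G (conj' x z)) (Nu.inr G (conj' y z)) := by
  have h : conj' (comm' (Monoid.Coprod.inl x) (Monoid.Coprod.inr y)) (Monoid.Coprod.inl z) *
        (comm' (Monoid.Coprod.inl (conj' x z)) (Monoid.Coprod.inr (conj' y z)))⁻¹ ∈
        Subgroup.normalClosure (nuRels G) :=
    Subgroup.subset_normalClosure ⟨x, y, z, Or.inl rfl⟩
  exact mul_inv_eq_one.mp ((QuotientGroup.eq_one_iff _).mpr h)

theorem Nu.conj_inr {G : Type u} [Group G] (x y z : G) :
    conj' (comm' (Nu.inl G x) (Nu.inr G y)) (Nu.inr G z) =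
      comm' (Nu.inl G (conj' x z)) (Nu.inr G (conj' y z)) := by
  have h : conj' (comm' (Monoid.Coprod.inl x) (Monoid.Coprod.inr y)) (Monoid.Coprod.inr z) *
        (comm' (Monoid.Coprod.inl (conj' x z)) (Monoid.Coprod.inr (conj' y z)))⁻¹ ∈
        Subgroup.normalClosure (nuRels G) :=
    Subgroup.subset_normalClosure ⟨x, y, z, Or.inr rfl⟩
  exact mul_inv_eq_one.mp ((QuotientGroup.eq_one_iff _).mpr h)

theorem nabla_conj_mem {G : Type u} [Group G] (w : Nu G) :
    ∀ a ∈ nabla G, conj' a w ∈ nabla G := by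
  -- conjugation by a fixed `w` is a homomorphism, so it suffices to look at the generators
  have key : ∀ w : Nu G, (∀ x : G, conj' (comm' (Nu.inl G x) (Nu.inr G x)) w ∈ nabla G) →
      ∀ a ∈ nabla G, conj' a w ∈ nabla G := by
    intro w hw a ha
    have hle : nabla G ≤ (nabla G).comap (MulAut.conj w⁻¹).toMonoidHom := by
      refine (Subgroup.closure_le _).mpr ?_
      rintro _ ⟨x, rfl⟩
      simpa [conj', mul_assoc] using hw x
    simpa [conj', mul_assoc] using hle ha
  obtain ⟨w, rfl⟩ := QuotientGroup.mk_surjective w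
  induction w using Monoid.Coprod.induction_on with
  | inl z =>
    refine key _ fun x => ?_
    have h : conj' (comm' (Nu.inl G x) (Nu.inr G x)) (Nu.inl G z) ∈ nabla G := by
      rw [Nu.conj_inl]
      exact Subgroup.subset_closure ⟨_, rfl⟩
    exact h
  | inr z =>
    refine key _ fun x => ?_
    have h : conj' (comm' (Nu.inl G x) (Nu.inr G x)) (Nu.inr G z) ∈ nabla G := by
      rw [Nu.conj_inr]
      exact Subgroup.subset_closure ⟨_, rfl⟩
    exact h
  | mul s t hs ht =>
    intro a ha
    have h := ht _ (hs a ha)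
    simpa [conj', mul_assoc] using h

instance nabla_normal (G : Type u) [Group G] : (nabla G).Normal where
  conj_mem a ha w := by
    simpa [conj'] using nabla_conj_mem w⁻¹ a ha

/-- The group `τ(G) = ν(G) / ∇(G)`. -/
abbrev Tau (G : Type u) [Group G] : Type u := Nu G ⧸ nabla G

/-! Part (b) rests on class two. An AI-automorphism α of G agrees with the identity on G', since a
commutator of class two depends only on its entries modulo the centre and is unchanged when both are
inverted. Hence α fixes the central element x^p. But α x = z x⁻¹ with z central of order dividing p,
so α also inverts x^p; as p is odd, x^p = 1.

For exponent p and order larger than p^3, every central extension of G still has class two. Indeed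
each g in G commutes with two elements x, y that do not commute with each other; lifts of x and y
have a commutator that commutes with every lift of g, and this commutator generates the derived
subgroup modulo the kernel. So an AI-automorphism of a Schur cover fixes the multiplier M pointwise.
If it also inverted M, then M, having exponent dividing p, would be trivial; but a bilinear cocycle
that is not symmetric on some commuting pair shows M ≠ 1. A cover with an AI-automorphism is the
relatively free group of class two and exponent p on a basis of G/G': inverting the free generators
gives the automorphism. It is a Schur cover because it maps to every extension of G by ℂˣ (p-th
roots of scalars correct the lifts of the generators), so transgression identifies the dual of its
kernel with H².

For order p^3, write G = F/N and R = [N,F]. The denominator of K̃(G,3) consists of the triples in N³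
whose product lies in R. The crucial object is an endomorphism β of F inducing inversion on both
F/F' and N/R (`exists_free_inversion`). Given β, the maps f ↦ (f, βf, 1) and f ↦ (f, 1, βf) descend
to G, and the commutators between them live in the first coordinate only; this yields the relations
of τ(G), hence a map τ(G) → K̃(G,3). To obtain β, an inversion of the Heisenberg group is lifted to
E = F/R, which has class at most three. It inverts triple commutators, and these exhaust E' ∩ N/R;
the remaining defect on N/R is a homomorphism that extends to E and can be divided out.

The map is onto because F' × 1 × 1 is reached by commutators. For injectivity, elements of τ(G) have
the form [a,b*]^i [a,c*]^j [b,c*]^k g h*, with c = [a,b] and the basic commutators of order dividing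
p; the exponent i is read off in G, and j, k in a class-three central extension of the Heisenberg
group. -/

section General

/-! ### Commutators and powers in groups of class two -/

open scoped commutatorElement

variable {G : Type*} [Group G]

theorem mul_pow_of_comm' {x d e : G} (h : d * x = x * d * e) (hx : Commute e x) (hd : Commute e d)
    (n : ℕ) : (x * d) ^ n = x ^ n * d ^ n * e ^ n.choose 2 := by
  have key : ∀ n : ℕ, d ^ n * x = x * d ^ n * e ^ n := by
    intro n
    induction n with
    | zero => simp
    | succ n ih =>
      calc d ^ (n + 1) * x = d * (d ^ n * x) := by rw [pow_succ']; group
        _ = (d * x) * d ^ n * e ^ n := by rw [ih]; group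
        _ = x * d * (e * d ^ n) * e ^ n := by rw [h]; group
        _ = x * d * (d ^ n * e) * e ^ n := by rw [(hd.pow_right n).eq]
        _ = _ := by rw [pow_succ' d, pow_succ' e]; group
  induction n with
  | zero => simp
  | succ n ih =>
    calc (x * d) ^ (n + 1) = x ^ n * d ^ n * (e ^ n.choose 2 * (x * d)) := by
          rw [pow_succ, ih]; group
      _ = x ^ n * d ^ n * (x * d * e ^ n.choose 2) := by
          rw [((hx.mul_right hd).pow_left _).eq]
      _ = x ^ n * (d ^ n * x) * d * e ^ n.choose 2 := by group
      _ = x ^ n * x * d ^ n * (e ^ n * d) * e ^ n.choose 2 := by rw [key]; group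
      _ = x ^ n * x * d ^ n * (d * e ^ n) * e ^ n.choose 2 := by rw [(hd.pow_left n).eq]
      _ = _ := by
          rw [Nat.choose_succ_succ' n 1, Nat.choose_one_right, pow_succ x, pow_succ d, pow_add]
          group

/-- The correction exponent `p.choose 2` is divisible by `p` because `p` is odd. -/
theorem mul_pow_of_comm'_pow_eq_one {p : ℕ} (hp : p.Prime) (hodd : Odd p) {x d e : G}
    (h : d * x = x * d * e) (hx : Commute e x) (hd : Commute e d) (he : e ^ p = 1) :
    (x * d) ^ p = x ^ p * d ^ p := by
  have h2 : 2 < p := lt_of_le_of_ne hp.two_le (by rintro rfl; exact absurd hodd (by decide))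
  obtain ⟨k, hk⟩ := hp.dvd_choose_self two_ne_zero h2
  rw [mul_pow_of_comm' h hx hd, hk, pow_mul, he, one_pow, mul_one]

theorem commutator_le_center_iff :
    commutator G ≤ Subgroup.center G ↔ ∀ x y z : G, Commute ⁅x, y⁆ z := by
  rw [commutator_def, Subgroup.commutator_le]
  simp only [Subgroup.mem_top, true_imp_iff, Subgroup.mem_center_iff]
  exact forall₂_congr fun x y => forall_congr' fun z => eq_comm

theorem commutatorElement_mem_commutator (x y : G) : ⁅x, y⁆ ∈ commutator G :=
  Subgroup.commutator_mem_commutator (Subgroup.mem_top _) (Subgroup.mem_top _)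

theorem isAI_iff {α : G ≃* G} : IsAI α ↔ ∀ x : G, α x * x ∈ commutator G := by
  have key : ∀ x : G, α.abelianizationCongr (Abelianization.of x) = (Abelianization.of x)⁻¹ ↔
      α x * x ∈ commutator G := by
    intro x
    rw [← Abelianization.ker_of, MonoidHom.mem_ker, map_mul, ← eq_inv_iff_mul_eq_one]
    rfl
  exact ⟨fun h x => (key x).1 (h _), fun h x => QuotientGroup.induction_on x fun x => (key x).2 (h x)⟩

theorem commutatorElement_mul_left_of_le_center (h : commutator G ≤ Subgroup.center G)
    (x y z : G) :
    ⁅x * y, z⁆ = ⁅x, z⁆ * ⁅y, z⁆ := by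
  have := commutator_le_center_iff.1 h y z x
  calc ⁅x * y, z⁆ = x * ⁅y, z⁆ * z * x⁻¹ * z⁻¹ := by simp only [commutatorElement_def]; group
    _ = ⁅y, z⁆ * x * z * x⁻¹ * z⁻¹ := by rw [this.eq]
    _ = ⁅y, z⁆ * ⁅x, z⁆ := by simp only [commutatorElement_def]; group
    _ = _ := commutator_le_center_iff.1 h y z _

/-- In a group of class two, the commutator with a fixed element is a homomorphism. -/
def commutatorHom (h : commutator G ≤ Subgroup.center G) (z : G) : G →* G where
  toFun x := ⁅x, z⁆
  map_one' := by simp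
  map_mul' x y := commutatorElement_mul_left_of_le_center h x y z

@[simp] theorem commutatorHom_apply (h : commutator G ≤ Subgroup.center G) (z x : G) :
    commutatorHom h z x = ⁅x, z⁆ := rfl

theorem commutatorElement_mul_center {x y z w : G} (hz : z ∈ Subgroup.center G)
    (hw : w ∈ Subgroup.center G) : ⁅x * z, y * w⁆ = ⁅x, y⁆ := by
  rw [Subgroup.mem_center_iff] at hz hw
  calc ⁅x * z, y * w⁆ = x * (z * (y * w)) * z⁻¹ * x⁻¹ * w⁻¹ * y⁻¹ := by
        simp only [commutatorElement_def]; group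
    _ = x * y * (w * x⁻¹) * w⁻¹ * y⁻¹ := by rw [← hz]; group
    _ = ⁅x, y⁆ := by rw [← hw]; simp only [commutatorElement_def]; group

theorem commutatorElement_inv_inv (h : commutator G ≤ Subgroup.center G) (x y : G) :
    ⁅x⁻¹, y⁻¹⁆ = ⁅x, y⁆ := by
  have h1 : ∀ x y : G, ⁅x⁻¹, y⁆ = ⁅x, y⁆⁻¹ := fun x y => map_inv (commutatorHom h y) x
  rw [h1, commutatorElement_inv, h1, commutatorElement_inv]

/-- If `g` induces the inverse of `f` modulo the centre of a group of class two, then `f` and `g`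
agree on commutators. -/
theorem eqOn_commutator_of_mul_mem_center {Q : Type*} [Group Q]
    (h : commutator Q ≤ Subgroup.center Q) (f g : G →* Q)
    (hfg : ∀ x, g x * f x ∈ Subgroup.center Q) {d : G} (hd : d ∈ commutator G) : g d = f d := by
  have hle : commutator G ≤ MonoidHom.eqLocus g f := by
    rw [commutator_def, Subgroup.commutator_le]
    intro x _ y _
    change g ⁅x, y⁆ = f ⁅x, y⁆
    have hx : ∀ x, g x = (f x)⁻¹ * (g x * f x) := fun x => by
      rw [← (Subgroup.mem_center_iff.1 (hfg x) (f x)⁻¹).symm]; group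
    rw [map_commutatorElement, map_commutatorElement, hx x, hx y,
      commutatorElement_mul_center (hfg x) (hfg y), commutatorElement_inv_inv h]
  exact hle hd

theorem isAI_apply_commutator (h : commutator G ≤ Subgroup.center G) {α : G ≃* G} (hα : IsAI α)
    {d : G} (hd : d ∈ commutator G) : α d = d :=
  eqOn_commutator_of_mul_mem_center h (MonoidHom.id G) α.toMonoidHom
    (fun x => h (isAI_iff.1 hα x)) hd

end General

/-! ### AI-automorphisms of extra-special groups -/

namespace IsExtraSpecial

open scoped commutatorElement

variable {p : ℕ} {G : Type u} [Group G]

theorem commutator_le_center (hG : IsExtraSpecial p G) : commutator G ≤ Subgroup.center G :=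
  hG.commutator_eq_center.le

theorem pow_eq_one (hG : IsExtraSpecial p G) {z : G} (hz : z ∈ Subgroup.center G) : z ^ p = 1 := by
  have h : (⟨z, hz⟩ : Subgroup.center G) ^ Nat.card (Subgroup.center G) = 1 := pow_card_eq_one'
  rw [hG.card_center] at h
  exact congrArg Subtype.val h

theorem pow_mem_center (hG : IsExtraSpecial p G) (x : G) : x ^ p ∈ Subgroup.center G := by
  rw [Subgroup.mem_center_iff]
  intro y
  have h : ⁅x ^ p, y⁆ = 1 := by
    rw [← commutatorHom_apply hG.commutator_le_center, map_pow]
    exact hG.pow_eq_one (hG.commutator_le_center (commutatorElement_mem_commutator _ _))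
  exact (commutatorElement_eq_one_iff_mul_comm.1 h).symm

/-- The central element `x ^ p` lies in the derived subgroup and so is fixed by `α`. It is also
inverted, since `α x` is `x⁻¹` times a central element of order dividing `p`. Hence its order
divides both 2 and `p`. -/
theorem pow_eq_one_of_isAI (hodd : Odd p) (hG : IsExtraSpecial p G) {α : G ≃* G}
    (hα : IsAI α) (x : G) : x ^ p = 1 := by
  have h1 : α (x ^ p) = x ^ p := isAI_apply_commutator hG.commutator_le_center hα
    (hG.commutator_eq_center ▸ hG.pow_mem_center x)
  have h2 : (α x * x) ∈ Subgroup.center G := hG.commutator_le_center (isAI_iff.1 hα x)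
  have h3 : α x = (α x * x) * x⁻¹ := by group
  have h4 : α (x ^ p) = (x ^ p)⁻¹ := by
    rw [map_pow, h3, Commute.mul_pow (Subgroup.mem_center_iff.1 h2 x⁻¹).symm, hG.pow_eq_one h2,
      one_mul, inv_pow]
  have h5 : (x ^ p) ^ 2 = 1 := by
    rw [pow_two]; nth_rewrite 1 [← h1]; rw [h4, inv_mul_cancel]
  have h6 : (x ^ p) ^ p = 1 := hG.pow_eq_one (hG.pow_mem_center x)
  have h7 : Nat.Coprime 2 p := (Nat.coprime_two_left).2 hodd
  exact orderOf_eq_one_iff.1 (Nat.eq_one_of_dvd_coprimes h7 (orderOf_dvd_of_pow_eq_one h5)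
    (orderOf_dvd_of_pow_eq_one h6))

end IsExtraSpecial

section ClassTwo

open scoped commutatorElement

variable {p : ℕ} {X : Type*} [Group X]

theorem pow_eq_one_of_mem_commutator (h : commutator X ≤ Subgroup.center X)
    (hpow : ∀ x : X, x ^ p ∈ Subgroup.center X) {d : X} (hd : d ∈ commutator X) : d ^ p = 1 := by
  have key : ∀ x y : X, ⁅x, y⁆ ^ p = 1 := fun x y => by
    rw [← commutatorHom_apply h, ← map_pow, commutatorHom_apply,
      commutatorElement_eq_one_iff_mul_comm]
    exact (Subgroup.mem_center_iff.1 (hpow x) y).symm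
  have hd' := hd
  rw [commutator_eq_closure] at hd'
  induction hd' using Subgroup.closure_induction with
  | mem x hx => obtain ⟨a, b, rfl⟩ := hx; exact key a b
  | one => exact one_pow _
  | mul x y hx hy ihx ihy =>
    rw [← commutator_eq_closure] at hx hy
    have hc : Commute x y := (Subgroup.mem_center_iff.1 (h hx) y).symm
    rw [hc.mul_pow, ihx hx, ihy hy, one_mul]
  | inv x hx ihx =>
    rw [← commutator_eq_closure] at hx
    rw [inv_pow, ihx hx, inv_one]

theorem mul_pow_of_class_two (hp : p.Prime) (hodd : Odd p)
    (h : commutator X ≤ Subgroup.center X) (hpow : ∀ d ∈ commutator X, d ^ p = 1) (x y : X) :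
    (x * y) ^ p = x ^ p * y ^ p := by
  have hc := commutator_le_center_iff.1 h
  refine mul_pow_of_comm'_pow_eq_one hp hodd (e := ⁅y⁻¹, x⁻¹⁆) ?_ (hc _ _ _) (hc _ _ _)
    (hpow _ (commutatorElement_mem_commutator _ _))
  simp only [commutatorElement_def]; group

end ClassTwo

/-! ### Centralisers and central extensions of extra-special groups -/

namespace IsExtraSpecial

open scoped commutatorElement

variable {p : ℕ} {G : Type u} [Group G]

theorem not_commute (hp : p.Prime) (hG : IsExtraSpecial p G) : ∃ x y : G, ¬ Commute x y := by
  by_contra! hcomm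
  have h1 : commutator G = ⊥ := by
    rw [eq_bot_iff, commutator_def, Subgroup.commutator_le]
    intro x _ y _
    exact Subgroup.mem_bot.2 (commutatorElement_eq_one_iff_mul_comm.2 (hcomm x y))
  have h2 := hG.card_center
  rw [← hG.commutator_eq_center, h1, Subgroup.card_bot] at h2
  exact hp.one_lt.ne h2

theorem card_le_mul_card_ker [Finite G] (hG : IsExtraSpecial p G) {K : Type*}
    [Group K] [Finite K] (f : K →* G) (hf : f.range ≤ Subgroup.center G) :
    Nat.card K ≤ p * Nat.card f.ker := by
  have h1 := Subgroup.card_mul_index f.ker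
  have h2 : Nat.card f.range ≤ p := hG.card_center ▸ Subgroup.card_le_of_le hf
  rw [Subgroup.index_ker] at h1
  rw [← h1, mul_comm]
  exact Nat.mul_le_mul_right _ h2

theorem range_commutatorHom_le (hG : IsExtraSpecial p G) (g : G) :
    (commutatorHom hG.commutator_le_center g).range ≤ Subgroup.center G := by
  rintro _ ⟨x, rfl⟩
  exact hG.commutator_le_center (commutatorElement_mem_commutator _ _)

/-- Otherwise the centraliser `K` of `g` is abelian, of index dividing `p`. Take `y` outside `K`. An
element of `K` commuting with `y` is centralised by `K` and by `y`, hence by all of `G` as the index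
is 1 or prime. So `K` meets the centraliser of `y` in at most `p` elements, and two index bounds
give `|G| ≤ p ^ 3`. -/
theorem exists_not_commute_of_lt_card [Finite G] (hp : p.Prime) (hG : IsExtraSpecial p G)
    (hcard : p ^ 3 < Nat.card G) (g : G) :
    ∃ x y : G, Commute x g ∧ Commute y g ∧ ¬ Commute x y := by
  have hc := hG.commutator_le_center
  by_contra! hK
  have hker : ∀ {x z : G}, x ∈ (commutatorHom hc z).ker ↔ Commute x z := fun {x z} => by
    rw [MonoidHom.mem_ker, commutatorHom_apply, commutatorElement_eq_one_iff_commute]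
  set K := (commutatorHom hc g).ker with hKdef
  have hKcard := hG.card_le_mul_card_ker _ (hG.range_commutatorHom_le g)
  obtain ⟨y, hy⟩ : ∃ y, y ∉ K := by
    by_contra! hall
    obtain ⟨a, b, hab⟩ := hG.not_commute hp
    exact hab (hK a b (hker.1 (hall a)) (hker.1 (hall b)))
  have hrange : ((commutatorHom hc y).comp K.subtype).range ≤ Subgroup.center G :=
    (by rintro _ ⟨x, rfl⟩; exact hG.range_commutatorHom_le y ⟨_, rfl⟩)
  have hcard2 := hG.card_le_mul_card_ker _ hrange
  have hidx : K.index ∣ p := by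
    rw [hKdef, Subgroup.index_ker, ← hG.card_center]
    exact Subgroup.card_dvd_of_le (hG.range_commutatorHom_le g)
  have hcentral : (((commutatorHom hc y).comp K.subtype).ker.map K.subtype) ≤
      Subgroup.center G := by
    rintro _ ⟨⟨z, hz⟩, hzy, rfl⟩
    change z ∈ _
    have hzy' : Commute z y := hker.1 hzy
    have hle : K ≤ Subgroup.centralizer {z} := fun k hk =>
      Subgroup.mem_centralizer_singleton_iff.2 (hK k z (hker.1 hk) (hker.1 hz))
    have hmul := Subgroup.relIndex_mul_index hle
    have htop : Subgroup.centralizer {z} = ⊤ := by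
      rw [← Subgroup.index_eq_one]
      rcases hp.eq_one_or_self_of_dvd _ ((Dvd.intro_left _ hmul).trans hidx) with h1 | h1
      · exact h1
      · exfalso
        have h2 : K.relIndex (Subgroup.centralizer {z}) = 1 := by
          have h3 : K.relIndex (Subgroup.centralizer {z}) * p ∣ 1 * p := by
            rw [one_mul]; nth_rewrite 1 [← h1]; rw [hmul]; exact hidx
          exact Nat.dvd_one.1 (Nat.dvd_of_mul_dvd_mul_right hp.pos h3)
        exact hy (Subgroup.relIndex_eq_one.1 h2
          (Subgroup.mem_centralizer_singleton_iff.2 hzy'.symm))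
    rw [Subgroup.mem_center_iff]
    intro w
    exact Subgroup.mem_centralizer_singleton_iff.1 (htop ▸ Subgroup.mem_top w)
  have hcard3 : Nat.card ((commutatorHom hc y).comp K.subtype).ker ≤ p := by
    rw [← hG.card_center, ← Subgroup.card_map_of_injective K.subtype_injective]
    exact Subgroup.card_le_of_le hcentral
  have : Nat.card G ≤ p ^ 3 :=
    calc Nat.card G ≤ p * Nat.card K := hKcard
      _ ≤ p * (p * p) := Nat.mul_le_mul_left _ (hcard2.trans (Nat.mul_le_mul_left _ hcard3))
      _ = p ^ 3 := by ring
  omega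

/-- A subgroup covering the group modulo the centre is everything. -/
theorem eq_top_of_forall_mul_center (hG : IsExtraSpecial p G) {K : Subgroup G}
    (hK : ∀ x, ∃ y ∈ K, ∃ z ∈ Subgroup.center G, x = y * z) : K = ⊤ := by
  have hcomm : commutator G ≤ K := by
    rw [commutator_def, Subgroup.commutator_le]
    intro x _ y _
    obtain ⟨x, hx, z, hz, rfl⟩ := hK x
    obtain ⟨y, hy, w, hw, rfl⟩ := hK y
    rw [commutatorElement_mul_center hz hw]
    exact mul_mem (mul_mem (mul_mem hx hy) (inv_mem hx)) (inv_mem hy)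
  rw [eq_top_iff]
  intro x _
  obtain ⟨y, hy, z, hz, rfl⟩ := hK x
  exact mul_mem hy (hcomm (hG.commutator_eq_center ▸ hz))

theorem center_le_zpowers (hp : p.Prime) (hG : IsExtraSpecial p G) {c : G}
    (hc : c ∈ Subgroup.center G) (hc1 : c ≠ 1) : Subgroup.center G ≤ Subgroup.zpowers c := by
  intro z hz
  have := Fact.mk hp
  have h := mem_zpowers_of_prime_card (p := p) hG.card_center (g := (⟨c, hc⟩ : Subgroup.center G))
    (g' := ⟨z, hz⟩) (fun h => hc1 (congrArg Subtype.val h))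
  obtain ⟨k, hk⟩ := h
  exact ⟨k, congrArg Subtype.val hk⟩

/-- A central extension of an extra-special group of order larger than `p ^ 3` has class two. -/
theorem commutator_le_center_of_central_extension [Finite G] (hp : p.Prime)
    (hG : IsExtraSpecial p G) (hcard : p ^ 3 < Nat.card G) {X : Type*} [Group X] {q : X →* G}
    (hq : Function.Surjective q) (hker : q.ker ≤ Subgroup.center X) :
    commutator X ≤ Subgroup.center X := by
  intro w hw
  rw [Subgroup.mem_center_iff]
  intro z
  -- Conjugation by `z` changes lifts of `x'` and `y'` only by central factors, so `z` commutes with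
  -- the commutator of the lifts.
  obtain ⟨x', y', hx, hy, hxy⟩ := hG.exists_not_commute_of_lt_card hp hcard (q z)
  obtain ⟨x, rfl⟩ := hq x'
  obtain ⟨y, rfl⟩ := hq y'
  have hcom : ∀ x, Commute (q x) (q z) → ∃ m ∈ Subgroup.center X, z * x * z⁻¹ = x * m := by
    intro x hx
    refine ⟨x⁻¹ * z * x * z⁻¹, hker ?_, by group⟩
    rw [MonoidHom.mem_ker]
    simp only [map_mul, map_inv]
    rw [mul_assoc _ (q z), ← hx.eq]; group
  obtain ⟨m, hm, hxm⟩ := hcom x hx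
  obtain ⟨m', hm', hym⟩ := hcom y hy
  have hz : Commute z ⁅x, y⁆ := by
    have : z * ⁅x, y⁆ * z⁻¹ = ⁅x, y⁆ := by
      have : z * ⁅x, y⁆ * z⁻¹ = ⁅z * x * z⁻¹, z * y * z⁻¹⁆ := by
        simp only [commutatorElement_def]; group
      rw [this, hxm, hym, commutatorElement_mul_center hm hm']
    exact mul_inv_eq_iff_eq_mul.1 this
  have hqc : q ⁅x, y⁆ ∈ Subgroup.center G := by
    rw [map_commutatorElement]
    exact hG.commutator_le_center (commutatorElement_mem_commutator _ _)
  have hq1 : q ⁅x, y⁆ ≠ 1 := by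
    rw [map_commutatorElement]
    exact fun h => hxy (commutatorElement_eq_one_iff_commute.1 h)
  have hqw : q w ∈ Subgroup.center G := by
    apply hG.commutator_le_center
    have : (commutator X).map q ≤ commutator G := by
      rw [commutator_def, Subgroup.map_commutator]
      exact Subgroup.commutator_mono le_top le_top
    exact this ⟨w, hw, rfl⟩
  -- The image of `⁅x, y⁆` is a nontrivial element of a centre of prime order, so `w` is a power of
  -- `⁅x, y⁆` times an element of the kernel, and `z` commutes with both factors.
  obtain ⟨k, hk⟩ := hG.center_le_zpowers hp hqc hq1 hqw
  have hm : w * (⁅x, y⁆ ^ k)⁻¹ ∈ Subgroup.center X := hker (by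
    rw [MonoidHom.mem_ker, map_mul, map_inv, map_zpow]
    exact mul_inv_eq_one.2 hk.symm)
  have h1 : Commute z (w * (⁅x, y⁆ ^ k)⁻¹) := Subgroup.mem_center_iff.1 hm z
  have h2 : w = w * (⁅x, y⁆ ^ k)⁻¹ * ⁅x, y⁆ ^ k := by group
  rw [h2]
  exact (h1.mul_right (hz.zpow_right k)).eq

end IsExtraSpecial

/-! ### The relatively free group of class two and exponent p -/

section

open scoped commutatorElement

/-- The relators of the relatively free group of class two and exponent `p`. -/
def classTwoRels (p : ℕ) (F : Type*) [Group F] : Set F :=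
  {w | ∃ x y z : F, w = ⁅⁅x, y⁆, z⁆} ∪
    {w | ∃ x : F, w = x ^ p}

/-- The relatively free group of class two and exponent `p` on `ι`. -/
abbrev FreeClassTwo (p : ℕ) (ι : Type*) : Type _ :=
  FreeGroup ι ⧸ Subgroup.normalClosure (classTwoRels p (FreeGroup ι))

end

namespace FreeClassTwo

open scoped commutatorElement

variable {p : ℕ} {ι : Type*}

/-- The free generators. -/
def of (i : ι) : FreeClassTwo p ι := QuotientGroup.mk' _ (FreeGroup.of i)

theorem commutator_le_center : commutator (FreeClassTwo p ι) ≤ Subgroup.center _ := by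
  rw [commutator_le_center_iff]
  intro x y z
  obtain ⟨x, rfl⟩ := QuotientGroup.mk'_surjective _ x
  obtain ⟨y, rfl⟩ := QuotientGroup.mk'_surjective _ y
  obtain ⟨z, rfl⟩ := QuotientGroup.mk'_surjective _ z
  rw [← commutatorElement_eq_one_iff_commute, ← map_commutatorElement, ← map_commutatorElement]
  exact (QuotientGroup.eq_one_iff _).2 (Subgroup.subset_normalClosure (Or.inl ⟨x, y, z, rfl⟩))

theorem pow_eq_one (x : FreeClassTwo p ι) : x ^ p = 1 := by
  obtain ⟨x, rfl⟩ := QuotientGroup.mk'_surjective _ x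
  rw [← map_pow]
  exact (QuotientGroup.eq_one_iff _).2 (Subgroup.subset_normalClosure (Or.inr ⟨x, rfl⟩))

/-- The target need not have exponent `p`: once `x ↦ x ^ p` is a homomorphism on it, this map is
trivial on the image of the free group as soon as it is trivial on the images of the generators.
This admits extensions by `ℂˣ` as targets. -/
theorem exists_lift {X : Type*} [Group X] (h : commutator X ≤ Subgroup.center X)
    (hpow : ∀ x y : X, (x * y) ^ p = x ^ p * y ^ p) (f : ι → X) (hf : ∀ i, f i ^ p = 1) :
    ∃ Φ : FreeClassTwo p ι →* X, ∀ i, Φ (of i) = f i := by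
  refine ⟨QuotientGroup.lift _ (FreeGroup.lift f) ?_, fun i => FreeGroup.lift_apply_of⟩
  have : Subgroup.normalClosure (classTwoRels p (FreeGroup ι)) ≤ (FreeGroup.lift f).ker := by
    refine Subgroup.normalClosure_le_normal ?_
    rintro w (⟨x, y, z, rfl⟩ | ⟨x, rfl⟩)
    · change FreeGroup.lift f ⁅⁅x, y⁆, z⁆ = 1
      rw [map_commutatorElement, map_commutatorElement, commutatorElement_eq_one_iff_commute]
      exact commutator_le_center_iff.1 h _ _ _
    · let P : X →* X := { toFun := fun x => x ^ p, map_one' := one_pow _, map_mul' := hpow }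
      have : P.comp (FreeGroup.lift f) = 1 := by
        ext i
        simp [P, hf]
      change FreeGroup.lift f (x ^ p) = 1
      rw [map_pow]
      exact DFunLike.congr_fun this x
  exact fun x hx => this hx

theorem hom_ext {X : Type*} [Monoid X] {f g : FreeClassTwo p ι →* X}
    (h : ∀ i, f (of i) = g (of i)) : f = g := by
  apply QuotientGroup.monoidHom_ext
  exact FreeGroup.ext_hom _ _ (fun i => h i)

theorem exists_isAI (hp : p.Prime) (hodd : Odd p) :
    ∃ α : FreeClassTwo p ι ≃* FreeClassTwo p ι, IsAI α := by
  obtain ⟨Φ, hΦ⟩ := exists_lift (p := p) (ι := ι) commutator_le_center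
    (mul_pow_of_class_two hp hodd commutator_le_center fun d _ => pow_eq_one d)
    (fun i => (of i)⁻¹) (fun i => pow_eq_one _)
  have hinv : Φ.comp Φ = MonoidHom.id _ := hom_ext fun i => by simp [hΦ]
  refine ⟨MonoidHom.toMulEquiv Φ Φ hinv hinv, isAI_iff.2 fun x => ?_⟩
  rw [← Abelianization.ker_of, MonoidHom.mem_ker, map_mul, ← eq_inv_iff_mul_eq_one]
  have : (Abelianization.of).comp Φ = (Abelianization.of (G := FreeClassTwo p ι))⁻¹ :=
    hom_ext fun i => by simp [hΦ]
  exact DFunLike.congr_fun this x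

end FreeClassTwo

/-! ### Cocycles, central extensions and factor sets -/

section Cohomology

/-- A normalisation-free multiplicative `2`-cocycle for the trivial action. -/
structure TrivialCocycle (G : Type u) (A : Type v) [Group G] [CommGroup A] where
  toFun : G → G → A
  cocycle : ∀ g h j : G, toFun (g * h) j * toFun g h = toFun h j * toFun g (h * j)

namespace TrivialCocycle

variable {G : Type u} {A : Type v} [Group G] [CommGroup A] (f : TrivialCocycle G A)

theorem map_one_left (g : G) : f.toFun 1 g = f.toFun 1 1 := by
  have h := f.cocycle 1 1 g
  rw [one_mul, one_mul, mul_comm] at h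
  exact (mul_right_cancel h).symm

theorem map_one_right (g : G) : f.toFun g 1 = f.toFun 1 1 := by
  have h := f.cocycle g 1 1
  rw [mul_one, mul_one] at h
  exact mul_right_cancel h

/-- The central extension of `G` by `A` defined by a cocycle. -/
@[ext] structure Ext (f : TrivialCocycle G A) where
  fst : A
  snd : G

namespace Ext

variable {f}

instance : Mul f.Ext := ⟨fun x y => ⟨x.fst * y.fst * f.toFun x.snd y.snd, x.snd * y.snd⟩⟩
-- Cocycles are not normalised, so the value at `(1, 1)` enters the identity, the inverse and the
-- inclusion of the kernel.
instance : One f.Ext := ⟨⟨(f.toFun 1 1)⁻¹, 1⟩⟩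
instance : Inv f.Ext :=
  ⟨fun x => ⟨x.fst⁻¹ * (f.toFun 1 1)⁻¹ * (f.toFun x.snd⁻¹ x.snd)⁻¹, x.snd⁻¹⟩⟩

@[simp] theorem mul_fst (x y : f.Ext) : (x * y).fst = x.fst * y.fst * f.toFun x.snd y.snd := rfl
@[simp] theorem mul_snd (x y : f.Ext) : (x * y).snd = x.snd * y.snd := rfl
@[simp] theorem one_fst : (1 : f.Ext).fst = (f.toFun 1 1)⁻¹ := rfl
@[simp] theorem one_snd : (1 : f.Ext).snd = 1 := rfl
@[simp] theorem inv_fst (x : f.Ext) :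
    x⁻¹.fst = x.fst⁻¹ * (f.toFun 1 1)⁻¹ * (f.toFun x.snd⁻¹ x.snd)⁻¹ := rfl
@[simp] theorem inv_snd (x : f.Ext) : x⁻¹.snd = x.snd⁻¹ := rfl

instance : Group f.Ext := Group.ofLeftAxioms
  (fun x y z => by
    ext
    · have := f.cocycle x.snd y.snd z.snd
      simp only [mul_fst, mul_snd]
      calc _ = x.fst * y.fst * z.fst * (f.toFun (x.snd * y.snd) z.snd * f.toFun x.snd y.snd) := by
            ac_rfl
        _ = _ := by rw [this]; ac_rfl
    · simp [mul_assoc])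
  (fun x => by
    ext
    · simp [f.map_one_left, mul_comm]
    · simp)
  (fun x => by
    ext
    · simp only [mul_fst, inv_fst, inv_snd, one_fst]
      calc _ = (x.fst⁻¹ * x.fst) * (f.toFun 1 1)⁻¹ *
            ((f.toFun x.snd⁻¹ x.snd)⁻¹ * f.toFun x.snd⁻¹ x.snd) := by ac_rfl
        _ = _ := by simp
    · simp)

variable (f)

/-- The projection of the extension onto `G`. -/
def proj : f.Ext →* G where
  toFun := Ext.snd
  map_one' := rfl
  map_mul' _ _ := rfl

/-- The inclusion of the kernel into the extension. -/
def incl : A →* f.Ext where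
  toFun a := ⟨a * (f.toFun 1 1)⁻¹, 1⟩
  map_one' := by ext <;> simp
  map_mul' a b := by
    ext
    · simp only [mul_fst]
      calc _ = a * b * (f.toFun 1 1)⁻¹ * ((f.toFun 1 1)⁻¹ * (f.toFun 1 1)) := by simp
        _ = _ := by ac_rfl
    · simp

theorem proj_surjective : Function.Surjective (proj f) := fun g => ⟨⟨1, g⟩, rfl⟩

theorem ker_proj : (proj f).ker = (incl f).range := by
  ext x
  constructor
  · intro hx
    refine ⟨x.fst * f.toFun 1 1, ?_⟩
    ext
    · simp [incl]
    · exact (MonoidHom.mem_ker.1 hx).symm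
  · rintro ⟨a, rfl⟩
    rfl

theorem range_incl_le_center : (incl f).range ≤ Subgroup.center f.Ext := by
  rintro _ ⟨a, rfl⟩
  rw [Subgroup.mem_center_iff]
  intro x
  ext
  · simp [incl, f.map_one_left, f.map_one_right, mul_comm]
  · simp [incl]

end Ext

end TrivialCocycle

section FactorSet

variable {G : Type u} {H : Type v} [Group G] [Group H] {π : H →* G}
  (hπ : Function.Surjective π)

/-- The factor set of a group extension. -/
noncomputable def factorSet (g h : G) : π.ker :=
  ⟨Function.surjInv hπ g * Function.surjInv hπ h * (Function.surjInv hπ (g * h))⁻¹, by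
    simp [MonoidHom.mem_ker, Function.surjInv_eq hπ]⟩

theorem factorSet_mul (g h : G) : (factorSet hπ g h : H) * Function.surjInv hπ (g * h) =
    Function.surjInv hπ g * Function.surjInv hπ h := by
  simp [factorSet]

theorem factorSet_cocycle (hc : π.ker ≤ Subgroup.center H) (g h j : G) :
    factorSet hπ (g * h) j * factorSet hπ g h = factorSet hπ h j * factorSet hπ g (h * j) := by
  have hcom : ∀ g h (x : H), Commute (factorSet hπ g h : H) x := fun g h x =>
    (Subgroup.mem_center_iff.1 (hc (factorSet hπ g h).2) x).symm
  apply Subtype.ext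
  apply mul_right_cancel (b := Function.surjInv hπ (g * h * j))
  simp only [Subgroup.coe_mul]
  calc _ = factorSet hπ g h * (factorSet hπ (g * h) j * Function.surjInv hπ (g * h * j)) := by
        rw [(hcom (g * h) j _).eq, mul_assoc]
    _ = Function.surjInv hπ g * (Function.surjInv hπ h * Function.surjInv hπ j) := by
        rw [factorSet_mul, ← mul_assoc, factorSet_mul, mul_assoc]
    _ = Function.surjInv hπ g * (factorSet hπ h j * Function.surjInv hπ (h * j)) := by
        rw [factorSet_mul]
    _ = factorSet hπ h j * (Function.surjInv hπ g * Function.surjInv hπ (h * j)) := by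
        rw [← mul_assoc, ← (hcom h j _).eq, mul_assoc]
    _ = factorSet hπ h j * (factorSet hπ g (h * j) * Function.surjInv hπ (g * (h * j))) := by
        rw [← factorSet_mul hπ g (h * j)]
    _ = _ := by rw [mul_assoc g, mul_assoc]

end FactorSet

variable (G : Type u) [Group G]

/-- The coefficients used for the Schur multiplier. -/
noncomputable abbrev multiplierRep : Rep (ULift.{u} ℤ) G :=
  Rep.trivial (ULift.{u} ℤ) G (ULift.{u} (Additive ℂˣ))

variable {G}

theorem mem_cocycles₂_multiplierRep (f : G → G → ℂˣ) :
    (fun x : G × G => (ULift.up (Additive.ofMul (f x.1 x.2)) : multiplierRep G)) ∈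
        groupCohomology.cocycles₂ (multiplierRep G) ↔
      ∀ g h j : G, f (g * h) j * f g h = f h j * f g (h * j) := by
  rw [groupCohomology.mem_cocycles₂_iff]
  exact forall₃_congr fun g h j =>
    ⟨fun H => congrArg (fun z : ULift.{u} (Additive ℂˣ) => Additive.toMul z.down) H,
      fun H => congrArg (fun z : ℂˣ => ULift.up (Additive.ofMul z)) H⟩

theorem mem_coboundaries₂_multiplierRep (f : G → G → ℂˣ) :
    (fun x : G × G => (ULift.up (Additive.ofMul (f x.1 x.2)) : multiplierRep G)) ∈
        groupCohomology.coboundaries₂ (multiplierRep G) ↔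
      ∃ t : G → ℂˣ, ∀ g h : G, t h / t (g * h) * t g = f g h := by
  constructor
  · rintro ⟨t, ht⟩
    exact ⟨fun g => Additive.toMul (t g : ULift.{u} (Additive ℂˣ)).down, fun g h =>
      congrArg (fun z : ULift.{u} (Additive ℂˣ) => Additive.toMul z.down) (congrFun ht (g, h))⟩
  · rintro ⟨t, ht⟩
    refine ⟨fun g => (ULift.up (Additive.ofMul (t g)) : multiplierRep G), funext fun x => ?_⟩
    exact congrArg (fun z : ℂˣ => ULift.up (Additive.ofMul z)) (ht x.1 x.2)

end Cohomology

/-! ### Transgression and a criterion for Schur covers -/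

section Transgression

open scoped commutatorElement

variable {G : Type u} {H : Type v} [Group G] [Group H] {π : H →* G}

/-- The cocycle obtained by applying a character of the kernel to the factor set of a central
extension. -/
noncomputable def transgressionCocycle (hπ : Function.Surjective π)
    (hc : π.ker ≤ Subgroup.center H) (χ : π.ker →* ℂˣ) :
    groupCohomology.cocycles₂ (multiplierRep G) :=
  ⟨fun x => ULift.up (Additive.ofMul (χ (factorSet hπ x.1 x.2))),
    (mem_cocycles₂_multiplierRep fun g h => χ (factorSet hπ g h)).2 fun g h j => by
      rw [← map_mul, ← map_mul, factorSet_cocycle hπ hc]⟩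

/-- The transgression map of a central extension. -/
noncomputable def transgression (hπ : Function.Surjective π) (hc : π.ker ≤ Subgroup.center H) :
    (π.ker →* ℂˣ) →* SchurMultiplier G where
  toFun χ := Multiplicative.ofAdd (groupCohomology.H2π _ (transgressionCocycle hπ hc χ))
  map_one' := by
    have : transgressionCocycle hπ hc 1 = 0 := rfl
    rw [this, map_zero]; rfl
  map_mul' χ ψ := by
    have : transgressionCocycle hπ hc (χ * ψ) =
      transgressionCocycle hπ hc χ + transgressionCocycle hπ hc ψ := rfl
    rw [this, map_add]; rfl

/-- If the transgressed cocycle is the coboundary of `t`, then `χ` of the kernel part times `t` of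
the image in `G` is a homomorphism on all of `H`. It kills the commutator subgroup, which contains
the kernel, and on the kernel it agrees with `χ`. -/
theorem transgression_injective (hπ : Function.Surjective π) (hc : π.ker ≤ Subgroup.center H)
    (hcomm : π.ker ≤ commutator H) : Function.Injective (transgression hπ hc) := by
  rw [injective_iff_map_eq_one]
  intro χ hχ
  obtain ⟨t, ht⟩ := (mem_coboundaries₂_multiplierRep fun g h => χ (factorSet hπ g h)).1
    ((groupCohomology.H2π_eq_zero_iff _).1 hχ)
  have hmem : ∀ x : H, x * (Function.surjInv hπ (π x))⁻¹ ∈ π.ker := fun x => by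
    rw [MonoidHom.mem_ker, map_mul, map_inv, Function.surjInv_eq hπ, mul_inv_cancel]
  let m : H → π.ker := fun x => ⟨_, hmem x⟩
  have hm : ∀ x y, m (x * y) = m x * m y * factorSet hπ (π x) (π y) := fun x y => by
    apply Subtype.ext
    have h1 : (m y : H) * Function.surjInv hπ (π x) = Function.surjInv hπ (π x) * m y :=
      (Subgroup.mem_center_iff.1 (hc (m y).2) _).symm
    have h2 : ∀ x, (m x : H) * Function.surjInv hπ (π x) = x := fun x => by simp [m]
    change x * y * (Function.surjInv hπ (π (x * y)))⁻¹ = m x * m y *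
      (Function.surjInv hπ (π x) * Function.surjInv hπ (π y) *
        (Function.surjInv hπ (π x * π y))⁻¹)
    nth_rewrite 1 [← h2 x, ← h2 y]
    rw [map_mul]
    calc _ = m x * (Function.surjInv hπ (π x) * m y) * Function.surjInv hπ (π y) *
          (Function.surjInv hπ (π x * π y))⁻¹ := by group
      _ = _ := by rw [← h1]; group
  let Ψ : H →* ℂˣ := MonoidHom.mk' (fun x => χ (m x) * t (π x)) fun x y => by
    simp only [hm, map_mul, ← ht]
    calc _ = χ (m x) * χ (m y) * (t (π y) * t (π x)) * (t (π x * π y) / t (π x * π y)) := by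
          simp only [div_eq_mul_inv]; ac_rfl
      _ = _ := by rw [div_self']; simp only [mul_one]; ac_rfl
  ext z
  have h1 : Ψ z = 1 := Abelianization.commutator_subset_ker Ψ (hcomm z.2)
  have h2 : Ψ 1 = 1 := map_one Ψ
  have h3 : m z = z * m 1 := by
    apply Subtype.ext
    simp [m, MonoidHom.mem_ker.1 z.2]
  have h4 : Ψ z = χ z * Ψ 1 := by
    simp [Ψ, h3, MonoidHom.mem_ker.1 z.2, mul_assoc]
  rw [h1, h2, mul_one] at h4
  rw [← h4]; rfl

/-- A map from `H` to the extension defined by a cocycle restricts to a character of the kernel; its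
first component along the section is the cochain relating the two cocycles. -/
theorem transgression_surjective (hπ : Function.Surjective π) (hc : π.ker ≤ Subgroup.center H)
    (hlift : ∀ f : TrivialCocycle G ℂˣ, ∃ Φ : H →* f.Ext, ∀ x, (Φ x).snd = π x) :
    Function.Surjective (transgression hπ hc) := by
  intro z
  induction z using Multiplicative.rec with | _ z
  induction z using groupCohomology.H2_induction_on with | _ f
  let f' : G → G → ℂˣ := fun g h => Additive.toMul (f (g, h) : ULift.{u} (Additive ℂˣ)).down
  let c : TrivialCocycle G ℂˣ := ⟨f', (mem_cocycles₂_multiplierRep f').1 f.2⟩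
  obtain ⟨Φ, hΦ⟩ := hlift c
  let χ : π.ker →* ℂˣ := MonoidHom.mk' (fun m => (Φ m).fst * c.toFun 1 1) fun x y => by
    simp only [Subgroup.coe_mul, map_mul, TrivialCocycle.Ext.mul_fst, hΦ, MonoidHom.mem_ker.1 x.2,
      MonoidHom.mem_ker.1 y.2]
    ac_rfl
  refine ⟨χ, ?_⟩
  apply congrArg Multiplicative.ofAdd
  rw [groupCohomology.H2π_eq_iff]
  refine (mem_coboundaries₂_multiplierRep fun g h => χ (factorSet hπ g h) / f' g h).2
    ⟨fun g => (Φ (Function.surjInv hπ g)).fst, fun g h => ?_⟩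
  have h1 := congrArg (fun x => (Φ x).fst) (factorSet_mul hπ g h)
  simp only [map_mul, TrivialCocycle.Ext.mul_fst, hΦ, Function.surjInv_eq hπ,
    MonoidHom.mem_ker.1 (factorSet hπ g h).2, c.map_one_left] at h1
  change _ = (Φ (factorSet hπ g h)).fst * c.toFun 1 1 / c.toFun g h
  rw [div_mul_eq_mul_div, div_eq_div_iff_mul_eq_mul]
  beta_reduce
  calc _ = (Φ (Function.surjInv hπ g)).fst * (Φ (Function.surjInv hπ h)).fst * c.toFun g h := by
        ac_rfl
    _ = _ := by rw [← h1]; ac_rfl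

/-- Commutators depend only on their entries modulo the central kernel, so there are finitely many;
then the commutator subgroup is finite (Schur), and with it the kernel. -/
theorem finite_of_ker_le [Finite G] (hπ : Function.Surjective π) (hc : π.ker ≤ Subgroup.center H)
    (hcomm : π.ker ≤ commutator H) : Finite H := by
  have hs : ∀ x : H, x * (Function.surjInv hπ (π x))⁻¹ ∈ π.ker := fun x => by
    rw [MonoidHom.mem_ker, map_mul, map_inv, Function.surjInv_eq hπ, mul_inv_cancel]
  have hfin : Finite (commutatorSet H) := by
    refine ((Set.finite_range fun x : G × G =>
      ⁅Function.surjInv hπ x.1, Function.surjInv hπ x.2⁆).subset ?_).to_subtype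
    rintro _ ⟨x, y, rfl⟩
    have hd : ∀ x : H, x = Function.surjInv hπ (π x) * (x * (Function.surjInv hπ (π x))⁻¹) :=
      fun x => by rw [Subgroup.mem_center_iff.1 (hc (hs x)) _, inv_mul_cancel_right]
    refine ⟨(π x, π y), ?_⟩
    nth_rewrite 2 [hd x, hd y]
    exact (commutatorElement_mul_center (hc (hs x)) (hc (hs y))).symm
  have : Finite π.ker := Finite.of_injective _ (Subgroup.inclusion_injective hcomm)
  refine Finite.of_injective (fun x : H => (π x, (⟨_, hs x⟩ : π.ker))) fun x y hxy => ?_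
  have h1 : π x = π y := congrArg Prod.fst hxy
  have h2 : x * (Function.surjInv hπ (π x))⁻¹ = y * (Function.surjInv hπ (π y))⁻¹ :=
    congrArg (fun z => (z.2 : H)) hxy
  rw [h1] at h2
  exact mul_right_cancel h2

/-- Transgression is bijective from the character group of the kernel, and a finite abelian group is
(non-canonically) isomorphic to its character group. -/
theorem isSchurCover_of_lift {H : Type u} [Group H] [Finite H] {π : H →* G}
    (hπ : Function.Surjective π) (hc : π.ker ≤ Subgroup.center H) (hcomm : π.ker ≤ commutator H)
    (hlift : ∀ f : TrivialCocycle G ℂˣ, ∃ Φ : H →* f.Ext, ∀ x, (Φ x).snd = π x) :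
    IsSchurCover π := by
  refine ⟨hπ, hcomm, hc, ?_⟩
  let _ : CommGroup π.ker :=
    { (inferInstance : Group π.ker) with
      mul_comm := fun a b => Subtype.ext (Subgroup.mem_center_iff.1 (hc b.2) a) }
  obtain ⟨e⟩ := CommGroup.monoidHom_mulEquiv_of_hasEnoughRootsOfUnity π.ker ℂ
  exact ⟨e.symm.trans (MulEquiv.ofBijective (transgression hπ hc)
    ⟨transgression_injective hπ hc hcomm, transgression_surjective hπ hc hlift⟩)⟩

end Transgression

/-- A cocycle that is not symmetric on commuting elements is not a coboundary. -/
theorem nontrivial_schurMultiplier_of_commute {G : Type u} [Group G] {A : Type*} [CommRing A]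
    (φ ψ : G →* Multiplicative A) (ζ : Multiplicative A →* ℂˣ) (hζ : Function.Injective ζ) {g h : G}
    (hgh : Commute g h)
    (hne : (φ g).toAdd * (ψ h).toAdd ≠ (φ h).toAdd * (ψ g).toAdd) :
    Nontrivial (SchurMultiplier G) := by
  let f : G → G → ℂˣ := fun x y => ζ (Multiplicative.ofAdd ((φ x).toAdd * (ψ y).toAdd))
  have hf : ∀ g h j : G, f (g * h) j * f g h = f h j * f g (h * j) := fun x y z => by
    simp only [f, ← map_mul, ← ofAdd_add]
    rw [map_mul φ, map_mul ψ, toAdd_mul, toAdd_mul]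
    ring_nf
  let F : groupCohomology.cocycles₂ (multiplierRep G) :=
    ⟨fun x => ULift.up (Additive.ofMul (f x.1 x.2)), (mem_cocycles₂_multiplierRep f).2 hf⟩
  refine ⟨Multiplicative.ofAdd (groupCohomology.H2π _ F), 1, fun h0 => ?_⟩
  obtain ⟨t, ht⟩ := (mem_coboundaries₂_multiplierRep f).1
    ((groupCohomology.H2π_eq_zero_iff F).1 h0)
  -- The coboundary of `t` at `(g, h)` is symmetric because `g * h = h * g`.
  have h1 : f g h = f h g := by
    rw [← ht, ← ht, hgh.eq, div_mul_eq_mul_div, div_mul_eq_mul_div, mul_comm]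
  exact hne (hζ h1)

/-- The abelianisation of a group of exponent `p` is a vector space over `ZMod p`. -/
theorem exists_vectorSpace_of_pow_eq_one {p : ℕ} {G : Type u} [Group G]
    (hexp : ∀ x : G, x ^ p = 1) :
    ∃ (V : Type u) (_ : AddCommGroup V) (_ : Module (ZMod p) V) (v : G →* Multiplicative V),
      Function.Surjective v ∧ v.ker = commutator G := by
  let V := Additive (Abelianization G)
  let _ : AddCommGroup V := inferInstanceAs (AddCommGroup (Additive (Abelianization G)))
  refine ⟨V, inferInstance, AddCommGroup.zmodModule fun x => ?_, Abelianization.of,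
    QuotientGroup.mk_surjective, Abelianization.ker_of _⟩
  obtain ⟨y, rfl⟩ := QuotientGroup.mk_surjective (x : Abelianization G)
  exact congrArg (Abelianization.of (G := G)) (hexp y)

/-! ### Schur covers of extra-special groups of order larger than p^3 -/

namespace IsExtraSpecial

open scoped commutatorElement

variable {p : ℕ} {G : Type u} [Group G]

/-- Otherwise the centraliser of a noncentral `g` has image of order at most `p` in the
abelianisation, hence order at most `p ^ 2`, and its index is at most `p`. -/
theorem exists_commute_notMem_zpowers [Finite G] (hp : p.Prime) (hG : IsExtraSpecial p G)
    (hcard : p ^ 3 < Nat.card G) (hexp : ∀ x : G, x ^ p = 1) :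
    ∃ g h : G, Commute g h ∧ Abelianization.of g ≠ 1 ∧
      Abelianization.of h ∉ Subgroup.zpowers (Abelianization.of g) := by
  have hc := hG.commutator_le_center
  obtain ⟨g, y, hgy⟩ := hG.not_commute hp
  have hg : Abelianization.of g ≠ 1 := fun h => by
    rw [← MonoidHom.mem_ker, Abelianization.ker_of] at h
    exact hgy (Subgroup.mem_center_iff.1 (hc h) y).symm
  by_contra! hcon
  have h1 := hG.card_le_mul_card_ker _ (hG.range_commutatorHom_le g)
  set K := (commutatorHom hc g).ker
  let f : K →* Abelianization G := Abelianization.of.comp K.subtype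
  have h2 := Subgroup.card_mul_index f.ker
  rw [Subgroup.index_ker] at h2
  have h3 : Nat.card f.range ≤ p := by
    have hle : f.range ≤ Subgroup.zpowers (Abelianization.of g) := by
      rintro _ ⟨x, rfl⟩
      exact hcon g x (commutatorElement_eq_one_iff_commute.1 x.2).symm hg
    refine (Subgroup.card_le_of_le hle).trans ?_
    rw [Nat.card_zpowers]
    exact orderOf_le_of_pow_eq_one hp.pos (by rw [← map_pow, hexp, map_one])
  have h4 : Nat.card f.ker ≤ p := by
    rw [← hG.card_center, ← Subgroup.card_map_of_injective K.subtype_injective]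
    apply Subgroup.card_le_of_le
    rintro _ ⟨x, hx, rfl⟩
    apply hc
    rw [← Abelianization.ker_of]
    exact hx
  have : Nat.card G ≤ p ^ 3 :=
    calc Nat.card G ≤ p * Nat.card K := h1
      _ ≤ p * (p * p) := by rw [← h2]; gcongr
      _ = p ^ 3 := by ring
  omega

theorem nontrivial_schurMultiplier [Finite G] (hp : p.Prime) (hG : IsExtraSpecial p G)
    (hcard : p ^ 3 < Nat.card G) (hexp : ∀ x : G, x ^ p = 1) :
    Nontrivial (SchurMultiplier G) := by
  -- Linear forms with `φ g ≠ 0`, `ψ h ≠ 0` and `ψ g = 0` make the bilinear cocycle `φ ψ` asymmetric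
  -- on the commuting pair.
  obtain ⟨g, h, hgh, hg, hh⟩ := hG.exists_commute_notMem_zpowers hp hcard hexp
  have := Fact.mk hp
  obtain ⟨V, _, _, v, hv, hvker⟩ := exists_vectorSpace_of_pow_eq_one hexp
  have hv1 : ∀ x y : G, v x = v y → Abelianization.of x = Abelianization.of y := fun x y hxy => by
    rw [← inv_mul_eq_one, ← map_inv, ← map_mul, ← MonoidHom.mem_ker, Abelianization.ker_of, ← hvker,
      MonoidHom.mem_ker, map_mul, map_inv, hxy, inv_mul_cancel]
  obtain ⟨φ, hφ, -⟩ := Submodule.exists_le_ker_of_notMem (K := ZMod p) (p := ⊥)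
    (v := (v g).toAdd) (fun h => hg (by
      rw [← map_one Abelianization.of]
      exact hv1 _ _ (((Submodule.mem_bot _).1 h).trans (map_one v).symm)))
  obtain ⟨ψ, hψ, hψg⟩ := Submodule.exists_le_ker_of_notMem
    (p := Submodule.span (ZMod p) {(v g).toAdd}) (v := (v h).toAdd) (fun hmem => hh (by
      obtain ⟨a, ha⟩ := Submodule.mem_span_singleton.1 hmem
      obtain ⟨k, rfl⟩ := ZMod.intCast_surjective a
      rw [Int.cast_smul_eq_zsmul] at ha
      refine ⟨k, ?_⟩
      change Abelianization.of g ^ k = _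
      rw [← map_zpow]
      exact hv1 _ _ ((map_zpow v g k).trans ha)))
  have hψg' : ψ (v g).toAdd = 0 := hψg (Submodule.mem_span_singleton_self _)
  let toHom : (V →ₗ[ZMod p] ZMod p) → (G →* Multiplicative (ZMod p)) :=
    fun φ => (AddMonoidHom.toMultiplicative φ.toAddMonoidHom).comp v
  refine nontrivial_schurMultiplier_of_commute (toHom φ) (toHom ψ)
    (Circle.toUnits.comp (ZMod.toCircle (N := p)).toMonoidHom) ?_ hgh ?_
  · refine Function.Injective.comp (g := Circle.toUnits) (fun a b hab => ?_)
      ZMod.injective_toCircle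
    exact Circle.ext (congrArg Units.val hab)
  · change φ (v g).toAdd * ψ (v h).toAdd ≠ φ (v h).toAdd * ψ (v g).toAdd
    rw [hψg', mul_zero]
    exact mul_ne_zero hφ hψ

/-- The cover has class two, so `α` fixes the kernel pointwise. Inverting it as well would force
exponent dividing both 2 and `p`, contradicting the nontriviality of the multiplier. -/
theorem not_forall_inv_of_isSchurCover [Finite G] (hp : p.Prime) (hodd : Odd p)
    (hG : IsExtraSpecial p G) (hcard : p ^ 3 < Nat.card G) (hexp : ∀ x : G, x ^ p = 1)
    {H : Type v} [Group H] {π : H →* G} (hπ : IsSchurCover π) {α : H ≃* H} (hα : IsAI α) :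
    ¬ ∀ m ∈ π.ker, α m = m⁻¹ := by
  intro hinv
  have hc := hG.commutator_le_center_of_central_extension hp hcard hπ.surjective hπ.ker_le_center
  have hker : ∀ m ∈ π.ker, m = 1 := fun m hm => by
    have h1 := hinv m hm
    rw [isAI_apply_commutator hc hα (hπ.ker_le_commutator hm)] at h1
    have h2 : m ^ 2 = 1 := by rw [pow_two]; nth_rewrite 2 [h1]; exact mul_inv_cancel m
    have h3 : m ^ p = 1 := pow_eq_one_of_mem_commutator hc
      (fun x => hπ.ker_le_center (by rw [MonoidHom.mem_ker, map_pow, hexp]))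
      (hπ.ker_le_commutator hm)
    exact orderOf_eq_one_iff.1 (Nat.eq_one_of_dvd_coprimes ((Nat.coprime_two_left).2 hodd)
      (orderOf_dvd_of_pow_eq_one h2) (orderOf_dvd_of_pow_eq_one h3))
  obtain ⟨e⟩ := hπ.ker_iso
  have := hG.nontrivial_schurMultiplier hp hcard hexp
  obtain ⟨x, y, hxy⟩ := exists_pair_ne (SchurMultiplier G)
  exact hxy (e.symm.injective (Subtype.ext ((hker _ (e.symm x).2).trans (hker _ (e.symm y).2).symm)))

theorem exists_isSchurCover_isAI [Finite G] (hp : p.Prime) (hodd : Odd p)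
    (hG : IsExtraSpecial p G) (hcard : p ^ 3 < Nat.card G) (hexp : ∀ x : G, x ^ p = 1) :
    ∃ (H : Type u) (_ : Group H) (π : H →* G), IsSchurCover π ∧ ∃ α : H ≃* H, IsAI α := by
  have := Fact.mk hp
  obtain ⟨V, _, _, v, hv, hvker⟩ := exists_vectorSpace_of_pow_eq_one hexp
  let b := Module.Basis.ofVectorSpace (ZMod p) V
  set ι := Module.Basis.ofVectorSpaceIndex (ZMod p) V
  have hgen : ∀ i : ι, ∃ g : G, v g = Multiplicative.ofAdd (b i) := fun i => hv _
  choose g hg using hgen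
  obtain ⟨π, hπ⟩ := FreeClassTwo.exists_lift hG.commutator_le_center
    (fun x y => by rw [hexp, hexp, hexp, one_mul]) g (fun i => hexp (g i))
  -- The image contains lifts of a basis of the abelianisation, hence covers `G` modulo its centre.
  have hsurj : Function.Surjective π := by
    let W : Submodule (ZMod p) V :=
      AddSubgroup.toZModSubmodule p (Subgroup.toAddSubgroup' (π.range.map v))
    have hW : ∀ x, x ∈ W := by
      intro x
      have : ⊤ ≤ W := by
        rw [← b.span_eq, Submodule.span_le]
        rintro _ ⟨i, rfl⟩
        exact ⟨g i, ⟨FreeClassTwo.of i, hπ i⟩, hg i⟩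
      exact this Submodule.mem_top
    rw [← MonoidHom.range_eq_top]
    refine hG.eq_top_of_forall_mul_center fun x => ?_
    obtain ⟨y, hy, hxy⟩ := hW (v x).toAdd
    refine ⟨y, hy, y⁻¹ * x, hG.commutator_le_center ?_, by group⟩
    rw [← hvker, MonoidHom.mem_ker, map_mul, map_inv, inv_mul_eq_one]
    exact hxy
  have hker : π.ker ≤ commutator (FreeClassTwo p ι) := by
    obtain ⟨V', _, _, v', -, hvker'⟩ :=
      exists_vectorSpace_of_pow_eq_one (G := FreeClassTwo p ι) FreeClassTwo.pow_eq_one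
    -- Since `b` is a basis of `V`, the abelianisation of the free object factors through `π`; so
    -- the kernel of `π` dies in it.
    let T : V →ₗ[ZMod p] V' := b.constr (ZMod p) fun i => (v' (FreeClassTwo.of i)).toAdd
    have hT : (AddMonoidHom.toMultiplicative T.toAddMonoidHom).comp (v.comp π) = v' := by
      apply FreeClassTwo.hom_ext
      intro i
      change Multiplicative.ofAdd (T (v (π (FreeClassTwo.of i))).toAdd) = _
      rw [hπ, hg]
      exact congrArg Multiplicative.ofAdd
        (b.constr_basis (ZMod p) (fun i => (v' (FreeClassTwo.of i)).toAdd) i)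
    intro x hx
    rw [← hvker', MonoidHom.mem_ker, ← hT]
    simp [MonoidHom.mem_ker.1 hx]
  have hkc : π.ker ≤ Subgroup.center _ := hker.trans FreeClassTwo.commutator_le_center
  have hfin : Finite (FreeClassTwo p ι) := finite_of_ker_le hsurj hkc hker
  refine ⟨FreeClassTwo p ι, inferInstance, π, isSchurCover_of_lift hsurj hkc hker ?_,
    FreeClassTwo.exists_isAI hp hodd⟩
  intro f
  have hX := hG.commutator_le_center_of_central_extension hp hcard
    (TrivialCocycle.Ext.proj_surjective f)
    ((TrivialCocycle.Ext.ker_proj f).le.trans (TrivialCocycle.Ext.range_incl_le_center f))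
  have hXpow : ∀ x : f.Ext, x ^ p ∈ (TrivialCocycle.Ext.incl f).range := fun x => by
    rw [← TrivialCocycle.Ext.ker_proj, MonoidHom.mem_ker, map_pow, hexp]
  have hXmul := mul_pow_of_class_two hp hodd hX fun d hd => pow_eq_one_of_mem_commutator hX
    (fun x => TrivialCocycle.Ext.range_incl_le_center f (hXpow x)) hd
  -- The `p`-th power of any lift is a scalar, and dividing the lift by a `p`-th root of that scalar
  -- gives a lift whose `p`-th power is 1.
  have hroot : ∀ g : G, ∃ x : f.Ext, x.snd = g ∧ x ^ p = 1 := fun g => by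
    obtain ⟨a, ha⟩ := hXpow ⟨1, g⟩
    obtain ⟨r, hr⟩ := IsAlgClosed.exists_pow_nat_eq ((a⁻¹ : ℂˣ) : ℂ) hp.pos
    let r' : ℂˣ := Units.mk0 r (by
      rintro rfl
      rw [zero_pow hp.ne_zero] at hr
      exact (a⁻¹).ne_zero hr.symm)
    have hr' : r' ^ p = a⁻¹ := Units.ext hr
    refine ⟨TrivialCocycle.Ext.incl f r' * ⟨1, g⟩, by simp [TrivialCocycle.Ext.incl], ?_⟩
    rw [hXmul, ← map_pow, hr', ← ha, ← map_mul, inv_mul_cancel, map_one]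
  choose r hr1 hr2 using hroot
  obtain ⟨Φ, hΦ⟩ := FreeClassTwo.exists_lift hX hXmul (fun i => r (g i)) fun i => hr2 _
  refine ⟨Φ, DFunLike.congr_fun (?_ : (TrivialCocycle.Ext.proj f).comp Φ = π)⟩
  apply FreeClassTwo.hom_ext
  intro i
  rw [MonoidHom.comp_apply, hΦ, hπ]
  exact hr1 _

end IsExtraSpecial

/-! ### The Heisenberg group and its class-three extension -/

section ZModPow

variable {p : ℕ} {G : Type*} [Group G]

/-- Powers of an element of order dividing `p` with exponents in `ZMod p`. -/
noncomputable def zmodPow (g : G) (hg : g ^ p = 1) (k : ZMod p) : G :=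
  (ZMod.lift p ⟨zmultiplesHom (Additive G) (Additive.ofMul g),
    by rw [zmultiplesHom_apply, natCast_zsmul]; exact hg⟩ k).toMul

@[simp] theorem zmodPow_intCast (g : G) (hg : g ^ p = 1) (k : ℤ) :
    zmodPow g hg (k : ZMod p) = g ^ k := by
  simp [zmodPow]

theorem zmodPow_add (g : G) (hg : g ^ p = 1) (k l : ZMod p) :
    zmodPow g hg (k + l) = zmodPow g hg k * zmodPow g hg l := by
  simp [zmodPow]

theorem zmodPow_zero (g : G) (hg : g ^ p = 1) : zmodPow g hg 0 = 1 := by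
  simp [zmodPow]

theorem zmodPow_one (g : G) (hg : g ^ p = 1) : zmodPow g hg 1 = g := by
  simpa using zmodPow_intCast g hg 1

end ZModPow

/-- The Heisenberg group over a ring. -/
@[ext] structure Heisenberg (R : Type*) where
  x : R
  y : R
  l : R

namespace Heisenberg

variable {R : Type*} [CommRing R]

instance : Mul (Heisenberg R) := ⟨fun a b => ⟨a.x + b.x, a.y + b.y + a.l * b.x, a.l + b.l⟩⟩
instance : One (Heisenberg R) := ⟨⟨0, 0, 0⟩⟩
instance : Inv (Heisenberg R) := ⟨fun a => ⟨-a.x, -a.y + a.l * a.x, -a.l⟩⟩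

theorem mul_def (a b : Heisenberg R) :
    a * b = ⟨a.x + b.x, a.y + b.y + a.l * b.x, a.l + b.l⟩ := rfl
theorem one_def : (1 : Heisenberg R) = ⟨0, 0, 0⟩ := rfl
theorem inv_def (a : Heisenberg R) : a⁻¹ = ⟨-a.x, -a.y + a.l * a.x, -a.l⟩ := rfl

instance : Group (Heisenberg R) := Group.ofLeftAxioms
  (fun a b c => by ext <;> simp only [mul_def] <;> ring)
  (fun a => by ext <;> simp [mul_def, one_def])
  (fun a => by ext <;> simp [mul_def, one_def, inv_def])

theorem mem_center {a : Heisenberg R} (hx : a.x = 0) (hl : a.l = 0) :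
    a ∈ Subgroup.center (Heisenberg R) := by
  rw [Subgroup.mem_center_iff]
  intro b
  ext <;> simp [mul_def, hx, hl, add_comm]

/-- The automorphism of the Heisenberg group inverting the two standard generators. -/
def invHom : Heisenberg R →* Heisenberg R where
  toFun a := ⟨-a.x, a.y, -a.l⟩
  map_one' := by simp [one_def]
  map_mul' a b := by ext <;> simp only [mul_def] <;> ring

/-- As a set, the Heisenberg group is `R × R × R`. -/
def equivProd : Heisenberg R ≃ R × R × R where
  toFun a := (a.x, a.y, a.l)
  invFun a := ⟨a.1, a.2.1, a.2.2⟩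

end Heisenberg

/-- A group of class three, for `2 * h = 1` a central extension of the Heisenberg group. -/
@[ext] structure HeisenbergExt {R : Type*} [CommRing R] (h : R) where
  x : R
  y : R
  z : R
  l : R

namespace HeisenbergExt

variable {R : Type*} [CommRing R] {h : R}

/-- A semidirect product: `l` acts on the triples `(x, y, z)` as the exponential of `l` times a
nilpotent Jordan block, with `h` in the role of one half. -/
instance : Mul (HeisenbergExt h) := ⟨fun a b =>
  ⟨a.x + b.x, a.y + b.y + a.l * b.x, a.z + b.z + a.l * b.y + h * a.l ^ 2 * b.x, a.l + b.l⟩⟩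
instance : One (HeisenbergExt h) := ⟨⟨0, 0, 0, 0⟩⟩
instance : Inv (HeisenbergExt h) :=
  ⟨fun a => ⟨-a.x, -a.y + a.l * a.x, -a.z + a.l * a.y - h * a.l ^ 2 * a.x, -a.l⟩⟩

theorem mul_def (a b : HeisenbergExt h) : a * b =
    ⟨a.x + b.x, a.y + b.y + a.l * b.x, a.z + b.z + a.l * b.y + h * a.l ^ 2 * b.x, a.l + b.l⟩ := rfl
theorem one_def : (1 : HeisenbergExt h) = ⟨0, 0, 0, 0⟩ := rfl
theorem inv_def (a : HeisenbergExt h) : a⁻¹ =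
    ⟨-a.x, -a.y + a.l * a.x, -a.z + a.l * a.y - h * a.l ^ 2 * a.x, -a.l⟩ := rfl

/-- The group structure on `HeisenbergExt h`. -/
abbrev group (hh : 2 * h = 1) : Group (HeisenbergExt h) := Group.ofLeftAxioms
  (fun a b c => by
    ext <;> simp only [mul_def]
    · ring
    · ring
    · linear_combination (a.l * b.l * c.x) * hh
    · ring)
  (fun a => by ext <;> simp [mul_def, one_def])
  (fun a => by
    ext <;> simp only [mul_def, one_def, inv_def]
    · ring
    · ring
    · ring
    · ring)

end HeisenbergExt

namespace IsExtraSpecial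

open scoped commutatorElement

variable {p : ℕ} {G : Type u} [Group G]

/-- A proper subgroup has order at most `p ^ 2` and is therefore abelian. -/
theorem closure_pair_eq_top (hp : p.Prime) (hcard : Nat.card G = p ^ 3) {a b : G}
    (hab : ¬ Commute a b) : Subgroup.closure {a, b} = ⊤ := by
  have := Fact.mk hp
  have hfin : Finite G := Nat.finite_of_card_ne_zero (by rw [hcard]; exact pow_ne_zero _ hp.ne_zero)
  set K := Subgroup.closure {a, b}
  have ha : a ∈ K := Subgroup.subset_closure (by simp)
  have hb : b ∈ K := Subgroup.subset_closure (by simp)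
  have hKab : ¬ Commute (⟨a, ha⟩ : K) ⟨b, hb⟩ := fun h => hab (congrArg Subtype.val h)
  obtain ⟨k, hk, hk'⟩ := (Nat.dvd_prime_pow hp).1 (hcard ▸ Subgroup.card_subgroup_dvd_card K)
  apply Subgroup.eq_top_of_card_eq
  interval_cases k
  · have : Subsingleton K := (Nat.card_eq_one_iff_unique.1 (by simpa using hk')).1
    exact absurd (Subsingleton.elim _ _) hKab
  · have : IsCyclic K := isCyclic_of_prime_card (p := p) (by simpa using hk')
    exact absurd (IsMulCommutative.is_comm.comm _ _) hKab
  · have := IsPGroup.isMulCommutative_of_card_eq_prime_sq hk'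
    exact absurd (IsMulCommutative.is_comm.comm _ _) hKab
  · rw [hk', hcard]

theorem commutator_zpow_zpow (h : commutator G ≤ Subgroup.center G) (a b : G) (k l : ℤ) :
    ⁅b ^ k, a ^ l⁆ = ⁅b, a⁆ ^ (k * l) := by
  have h1 : ∀ x y : G, ∀ k : ℤ, ⁅x ^ k, y⁆ = ⁅x, y⁆ ^ k := fun x y k =>
    map_zpow (commutatorHom h y) x k
  rw [h1, ← inv_inj, ← inv_zpow, commutatorElement_inv, h1, ← commutatorElement_inv b a, inv_zpow,
    inv_zpow, ← zpow_mul, mul_comm l k]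

/-- The map is `(x, y, l) ↦ a ^ x * ⁅b, a⁆ ^ y * b ^ l`; it is onto since `a` and `b` generate, and
bijective by counting. Any noncommuting pair may serve as standard generators, in either order. -/
theorem exists_heisenberg_equiv (hp : p.Prime) (hG : IsExtraSpecial p G)
    (hcard : Nat.card G = p ^ 3) (hexp : ∀ x : G, x ^ p = 1) {a b : G} (hab : ¬ Commute a b) :
    ∃ e : Heisenberg (ZMod p) ≃* G, e ⟨1, 0, 0⟩ = a ∧ e ⟨0, 0, 1⟩ = b := by
  have := Fact.mk hp
  have hc : ⁅b, a⁆ ∈ Subgroup.center G :=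
    hG.commutator_le_center (commutatorElement_mem_commutator _ _)
  have hcc : ∀ (k : ZMod p) (x : G), Commute (zmodPow _ (hexp ⁅b, a⁆) k) x := fun k x => by
    obtain ⟨k, rfl⟩ := ZMod.intCast_surjective k
    rw [zmodPow_intCast]
    exact (show Commute ⁅b, a⁆ x from (Subgroup.mem_center_iff.1 hc x).symm).zpow_left k
  have hba : ∀ k l : ZMod p, zmodPow b (hexp b) k * zmodPow a (hexp a) l =
      zmodPow _ (hexp ⁅b, a⁆) (k * l) * zmodPow a (hexp a) l * zmodPow b (hexp b) k := fun k l => by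
    obtain ⟨k, rfl⟩ := ZMod.intCast_surjective k
    obtain ⟨l, rfl⟩ := ZMod.intCast_surjective l
    rw [← Int.cast_mul, zmodPow_intCast, zmodPow_intCast, zmodPow_intCast,
      ← commutator_zpow_zpow hG.commutator_le_center]
    simp only [commutatorElement_def]; group
  let f : Heisenberg (ZMod p) →* G := MonoidHom.mk'
    (fun v => zmodPow a (hexp a) v.x * zmodPow _ (hexp ⁅b, a⁆) v.y * zmodPow b (hexp b) v.l)
    fun v w => by
      simp only [Heisenberg.mul_def, zmodPow_add]
      have h1 := hba v.l w.x
      have h2 := hcc (v.l * w.x)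
      have h3 := hcc w.y
      calc _ = zmodPow a (hexp a) v.x * (zmodPow a (hexp a) w.x * zmodPow _ (hexp ⁅b, a⁆) v.y) *
            (zmodPow _ (hexp ⁅b, a⁆) w.y * (zmodPow _ (hexp ⁅b, a⁆) (v.l * w.x) *
              zmodPow b (hexp b) v.l)) * zmodPow b (hexp b) w.l := by group
        _ = zmodPow a (hexp a) v.x * zmodPow _ (hexp ⁅b, a⁆) v.y * (zmodPow a (hexp a) w.x *
            (zmodPow _ (hexp ⁅b, a⁆) (v.l * w.x) * zmodPow b (hexp b) v.l)) *
              zmodPow _ (hexp ⁅b, a⁆) w.y * zmodPow b (hexp b) w.l := by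
            rw [← (hcc v.y _).eq, (h3 _).eq]; group
        _ = zmodPow a (hexp a) v.x * zmodPow _ (hexp ⁅b, a⁆) v.y * (zmodPow b (hexp b) v.l *
            zmodPow a (hexp a) w.x) *
              zmodPow _ (hexp ⁅b, a⁆) w.y * zmodPow b (hexp b) w.l := by
            rw [h1, (h2 (zmodPow a (hexp a) w.x)).eq]; group
        _ = _ := by group
  have hfa : f ⟨1, 0, 0⟩ = a := by simp [f, zmodPow_zero, zmodPow_one]
  have hfb : f ⟨0, 0, 1⟩ = b := by simp [f, zmodPow_zero, zmodPow_one]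
  have hsurj : Function.Surjective f := by
    rw [← MonoidHom.range_eq_top, eq_top_iff, ← closure_pair_eq_top hp hcard hab,
      Subgroup.closure_le]
    rintro x (rfl | rfl)
    · exact ⟨_, hfa⟩
    · exact ⟨_, hfb⟩
  have hfin : Finite (Heisenberg (ZMod p)) := Finite.of_equiv _ Heisenberg.equivProd.symm
  have hbij : Function.Bijective f := hsurj.bijective_of_nat_card_le (by
    rw [Nat.card_congr Heisenberg.equivProd, hcard, Nat.card_prod, Nat.card_prod, Nat.card_zmod]
    exact le_of_eq (by ring))
  exact ⟨MulEquiv.ofBijective f hbij, hfa, hfb⟩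

/-- An extra-special group of order `p ^ 3` and exponent `p` has an endomorphism inverting the
abelianisation. -/
theorem exists_hom_mul_mem_commutator (hp : p.Prime) (hG : IsExtraSpecial p G)
    (hcard : Nat.card G = p ^ 3) (hexp : ∀ x : G, x ^ p = 1) :
    ∃ α : G →* G, ∀ x, α x * x ∈ commutator G := by
  obtain ⟨a, b, hab⟩ := hG.not_commute hp
  obtain ⟨e, -, -⟩ := hG.exists_heisenberg_equiv hp hcard hexp hab
  refine ⟨e.toMonoidHom.comp (Heisenberg.invHom.comp e.symm.toMonoidHom), fun x => ?_⟩
  obtain ⟨v, rfl⟩ := e.surjective x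
  have h : Heisenberg.invHom v * v ∈ Subgroup.center (Heisenberg (ZMod p)) :=
    Heisenberg.mem_center (by simp [Heisenberg.mul_def, Heisenberg.invHom])
      (by simp [Heisenberg.mul_def, Heisenberg.invHom])
  rw [hG.commutator_eq_center, Subgroup.mem_center_iff]
  intro y
  obtain ⟨w, rfl⟩ := e.surjective y
  simpa using congrArg e (Subgroup.mem_center_iff.1 h w)

/-- A homomorphism from a free cover detecting one of the triple commutators. -/
theorem exists_hom_detecting (hp : p.Prime) (hodd : Odd p) (hG : IsExtraSpecial p G)
    (hcard : Nat.card G = p ^ 3) (hexp : ∀ x : G, x ^ p = 1) {ι : Type w} (π : FreeGroup ι →* G)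
    {u v c : FreeGroup ι} (huv : ¬ Commute (π u) (π v)) (hc : π c ∈ Subgroup.center G)
    (hc1 : π c ≠ 1) :
    ∃ (Q : Type) (_ : Group Q) (χ : FreeGroup ι →* Q), (∀ n ∈ π.ker, ∀ f, Commute (χ n) (χ f)) ∧
      χ (comm' u c) = 1 ∧ ∀ j : ℤ, χ (comm' v c ^ j) = 1 → (p : ℤ) ∣ j := by
  have := Fact.mk hp
  obtain ⟨e, heu, hev⟩ := hG.exists_heisenberg_equiv hp hcard hexp huv
  have h2 : (2 : ZMod p) ≠ 0 := by
    intro h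
    have h3 : p ∣ 2 := (ZMod.natCast_eq_zero_iff 2 p).1 (by exact_mod_cast h)
    have h4 := (Nat.prime_dvd_prime_iff_eq hp Nat.prime_two).1 h3
    rw [h4] at hodd
    exact absurd hodd (by decide)
  let h : ZMod p := 2⁻¹
  let _ : Group (HeisenbergExt h) := HeisenbergExt.group (mul_inv_cancel₀ h2)
  let r : HeisenbergExt h →* Heisenberg (ZMod p) :=
    { toFun := fun a => ⟨a.x, a.y, a.l⟩, map_one' := rfl, map_mul' := fun _ _ => rfl }
  -- Each generator is lifted with `z = 0`, an arbitrary choice. Elements of the kernel of `π` then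
  -- land among those with only a `z`-coordinate, which are central.
  let χ : FreeGroup ι →* HeisenbergExt h := FreeGroup.lift fun i =>
    ⟨(e.symm (π (FreeGroup.of i))).x, (e.symm (π (FreeGroup.of i))).y, 0,
      (e.symm (π (FreeGroup.of i))).l⟩
  have hχ : ∀ f, r (χ f) = e.symm (π f) := fun f => DFunLike.congr_fun
    (FreeGroup.ext_hom (r.comp χ) (e.symm.toMonoidHom.comp π) fun i => by
      simp [χ, r]) f
  have hχ' : ∀ {f : FreeGroup ι} {v : Heisenberg (ZMod p)}, e v = π f →
      (χ f).x = v.x ∧ (χ f).y = v.y ∧ (χ f).l = v.l := fun {f v} hv => by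
    have := hχ f
    rw [← hv, e.symm_apply_apply] at this
    rw [← this]
    exact ⟨rfl, rfl, rfl⟩
  obtain ⟨hu1, hu2, hu3⟩ := hχ' heu
  obtain ⟨hv1, hv2, hv3⟩ := hχ' hev
  obtain ⟨hc2, hc3, hc4⟩ := hχ' (e.apply_symm_apply (π c))
  have hcomm : ∀ w, w * e.symm (π c) = e.symm (π c) * w := fun w => by
    have := Subgroup.mem_center_iff.1 hc (e w)
    simpa using congrArg e.symm this
  have hcx : (e.symm (π c)).x = 0 := by
    simpa [Heisenberg.mul_def] using congrArg Heisenberg.y (hcomm ⟨0, 0, 1⟩)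
  have hcl : (e.symm (π c)).l = 0 := by
    simpa [Heisenberg.mul_def] using congrArg Heisenberg.y (hcomm ⟨1, 0, 0⟩)
  set y := (e.symm (π c)).y with hy
  have hy0 : y ≠ 0 := fun h0 => by
    apply hc1
    have : e.symm (π c) = 1 := by ext <;> simp [hcx, hcl, ← hy, h0, Heisenberg.one_def]
    simpa using this
  -- Modulo `z`, the images of `u`, `v`, `c` are `(1, 0, 0)`, `(0, 0, 1)`, `(0, y, 0)` with `y ≠ 0`.
  -- Only an `l`-coordinate acts on `y`, so `c` commutes with `u` but its commutator with `v` has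
  -- `z`-coordinate `y`.
  have key : ∀ {w : FreeGroup ι} {t : ZMod p}, χ c * χ w * ⟨0, 0, t, 0⟩ = χ w * χ c →
      χ (comm' w c) = ⟨0, 0, t, 0⟩ := fun {w t} hw => by
    rw [comm', map_mul, map_mul, map_mul, map_inv, map_inv, mul_assoc _ (χ w), ← hw]; group
  have hpow : ∀ n : ℕ, (⟨0, 0, y, 0⟩ : HeisenbergExt h) ^ n = ⟨0, 0, n * y, 0⟩ := by
    intro n
    induction n with
    | zero => ext <;> simp [HeisenbergExt.one_def]
    | succ n ih => rw [pow_succ, ih]; ext <;> simp [HeisenbergExt.mul_def, add_mul]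
  refine ⟨HeisenbergExt h, inferInstance, χ, ?_, ?_, ?_⟩
  · intro n hn f
    have hn1 : e 1 = π n := by rw [map_one]; exact (MonoidHom.mem_ker.1 hn).symm
    obtain ⟨h3, h4, h5⟩ := hχ' hn1
    rw [Heisenberg.one_def] at h3 h4 h5
    change χ n * χ f = χ f * χ n
    ext <;> simp [HeisenbergExt.mul_def, h3, h4, h5, add_comm]
  · refine (key (t := 0) ?_).trans rfl
    ext <;> simp [HeisenbergExt.mul_def, hu1, hu2, hu3, hc2, hc3, hc4, hcx, hcl, add_comm]
  · intro j hj
    rw [map_zpow, key (t := y), ← orderOf_dvd_iff_zpow_eq_one,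
      orderOf_eq_prime (p := p) (by rw [hpow, CharP.cast_eq_zero, zero_mul]; rfl)] at hj
    · exact hj
    · exact fun h0 => hy0 (congrArg HeisenbergExt.z h0)
    · ext <;> simp [HeisenbergExt.mul_def, hv1, hv2, hv3, hc2, hc3, hc4, hcx, hcl, add_comm]

end IsExtraSpecial

/-! ### Central extensions of groups of class two and exponent p -/

section CentralExtension

open scoped commutatorElement

variable {p : ℕ} {G : Type u} [Group G] {E : Type v} [Group E] {ρ : E →* G}

theorem mul_mem_comm_commutator {x y : E} (h : x * y ∈ commutator E) : y * x ∈ commutator E := by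
  have := (inferInstance : (commutator E).Normal).conj_mem _ h y
  simpa [mul_assoc] using this

theorem map_commutator_le (ρ : E →* G) : (commutator E).map ρ ≤ commutator G := by
  rw [commutator_def, Subgroup.map_commutator]
  exact Subgroup.commutator_mono le_top le_top

theorem commutatorElement_mem_ker (hG : commutator G ≤ Subgroup.center G) {d : E}
    (hd : d ∈ commutator E) (x : E) : ⁅d, x⁆ ∈ ρ.ker := by
  rw [MonoidHom.mem_ker, map_commutatorElement, commutatorElement_eq_one_iff_mul_comm]
  exact (Subgroup.mem_center_iff.1 (hG (map_commutator_le ρ ⟨d, hd, rfl⟩)) _).symm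

/-- If all commutators with `d` are central, commutation with `d` is a homomorphism. -/
def commutatorLeftHom (d : E) (hd : ∀ x, ⁅d, x⁆ ∈ Subgroup.center E) : E →* E :=
  MonoidHom.mk' (fun x => ⁅d, x⁆) fun x y => by
    calc ⁅d, x * y⁆ = ⁅d, x⁆ * (x * ⁅d, y⁆) * x⁻¹ := by simp only [commutatorElement_def]; group
      _ = _ := by rw [Subgroup.mem_center_iff.1 (hd y) x]; group

/-- Commutation with `d` is a homomorphism with central, hence commuting, values, so it kills
commutators. -/
theorem commutatorElement_eq_one_of_mem_commutator (hc : ρ.ker ≤ Subgroup.center E)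
    (hG : commutator G ≤ Subgroup.center G) {d d' : E} (hd : d ∈ commutator E)
    (hd' : d' ∈ commutator E) : ⁅d, d'⁆ = 1 := by
  have hcen : ∀ x, ⁅d, x⁆ ∈ Subgroup.center E := fun x => hc (commutatorElement_mem_ker hG hd x)
  have hle : commutator E ≤ (commutatorLeftHom d hcen).ker := by
    rw [commutator_def, Subgroup.commutator_le]
    intro x _ y _
    rw [MonoidHom.mem_ker, map_commutatorElement, commutatorElement_eq_one_iff_mul_comm]
    exact (Subgroup.mem_center_iff.1 (hcen x) _).symm
  exact hle hd'

theorem commutatorElement_pow_eq_one (hc : ρ.ker ≤ Subgroup.center E)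
    (hG : commutator G ≤ Subgroup.center G) (hexp : ∀ x : G, x ^ p = 1) {d : E}
    (hd : d ∈ commutator E) (x : E) : ⁅d, x⁆ ^ p = 1 := by
  have hcen : ∀ x, ⁅d, x⁆ ∈ Subgroup.center E := fun x => hc (commutatorElement_mem_ker hG hd x)
  have h1 : ⁅d, x⁆ ^ p = ⁅d, x ^ p⁆ := (map_pow (commutatorLeftHom d hcen) x p).symm
  rw [h1, commutatorElement_eq_one_iff_mul_comm]
  exact Subgroup.mem_center_iff.1 (hc (by rw [MonoidHom.mem_ker, map_pow, hexp])) d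

theorem mul_pow_of_mem_commutator (hp : p.Prime) (hodd : Odd p) (hc : ρ.ker ≤ Subgroup.center E)
    (hG : commutator G ≤ Subgroup.center G) (hexp : ∀ x : G, x ^ p = 1) (x : E) {d : E}
    (hd : d ∈ commutator E) : (x * d) ^ p = x ^ p * d ^ p := by
  have hcom : ∀ y, Commute ⁅d⁻¹, x⁻¹⁆ y := fun y =>
    (Subgroup.mem_center_iff.1 (hc (commutatorElement_mem_ker hG (inv_mem hd) x⁻¹)) y).symm
  refine mul_pow_of_comm'_pow_eq_one hp hodd (e := ⁅d⁻¹, x⁻¹⁆) ?_ (hcom _) (hcom _)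
    (commutatorElement_pow_eq_one hc hG hexp (inv_mem hd) _)
  simp only [commutatorElement_def]; group

theorem pow_eq_one_of_mem_commutator_of_central (hp : p.Prime) (hodd : Odd p)
    (hc : ρ.ker ≤ Subgroup.center E) (hG : commutator G ≤ Subgroup.center G)
    (hexp : ∀ x : G, x ^ p = 1) {d : E} (hd : d ∈ commutator E) : d ^ p = 1 := by
  -- `x⁻¹ * ⁅x, y⁆` is a conjugate of `x⁻¹`, whose `p`-th power is central. Comparing with the
  -- product formula leaves `⁅x, y⁆ ^ p = 1`.
  have key : ∀ x y : E, ⁅x, y⁆ ^ p = 1 := fun x y => by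
    have h1 := mul_pow_of_mem_commutator hp hodd hc hG hexp x⁻¹
      (commutatorElement_mem_commutator x y)
    have h2 : x⁻¹ * ⁅x, y⁆ = y * x⁻¹ * y⁻¹ := by simp only [commutatorElement_def]; group
    have h3 : (x⁻¹) ^ p ∈ Subgroup.center E := hc (by rw [MonoidHom.mem_ker, map_pow, hexp])
    rw [h2, conj_pow, Subgroup.mem_center_iff.1 h3 y, mul_inv_cancel_right] at h1
    exact (mul_eq_left.1 h1.symm)
  have hd' := hd
  rw [commutator_eq_closure] at hd'
  induction hd' using Subgroup.closure_induction with
  | mem x hx => obtain ⟨a, b, rfl⟩ := hx; exact key a b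
  | one => exact one_pow _
  | mul x y hx hy ihx ihy =>
    rw [← commutator_eq_closure] at hx hy
    have hxy : Commute x y := commutatorElement_eq_one_iff_commute.1
      (commutatorElement_eq_one_of_mem_commutator hc hG hx hy)
    rw [hxy.mul_pow, ihx hx, ihy hy, one_mul]
  | inv x hx ihx =>
    rw [← commutator_eq_closure] at hx
    rw [inv_pow, ihx hx, inv_one]

/-- Over a group of class two generated by two elements, the commutators in the kernel of a
central extension are products of triple commutators. -/
theorem mem_triple_commutator (hp : p.Prime) (hodd : Odd p)
    (hc : ρ.ker ≤ Subgroup.center E) (hG : commutator G ≤ Subgroup.center G)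
    (hexp : ∀ x : G, x ^ p = 1) {a b : E} (hgen : Subgroup.closure {ρ a, ρ b} = ⊤)
    (hab : ρ ⁅a, b⁆ ≠ 1)     {m : E} (hm : m ∈ commutator E) (hmk : m ∈ ρ.ker) : m ∈ ⁅commutator E, (⊤ : Subgroup E)⁆ := by
  have := Fact.mk hp
  set Γ := ⁅commutator E, (⊤ : Subgroup E)⁆
  have hΓ : Γ ≤ ρ.ker := Subgroup.commutator_le.2 fun d hd x _ => commutatorElement_mem_ker hG hd x
  -- The quotient by `P` is abelian: it is generated by the commuting images of `a` and `b` and the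
  -- central image of the kernel. So the commutator subgroup is generated by `⁅a, b⁆` modulo triple
  -- commutators.
  let P := (Subgroup.zpowers (QuotientGroup.mk' Γ ⁅a, b⁆)).comap (QuotientGroup.mk' Γ)
  have hcen : ∀ d ∈ commutator E, QuotientGroup.mk' Γ d ∈ Subgroup.center (E ⧸ Γ) := by
    intro d hd
    rw [Subgroup.mem_center_iff]
    intro x
    obtain ⟨x, rfl⟩ := QuotientGroup.mk'_surjective _ x
    have : QuotientGroup.mk' Γ ⁅d, x⁆ = 1 := (QuotientGroup.eq_one_iff _).2
      (Subgroup.commutator_mem_commutator hd (Subgroup.mem_top _))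
    rw [map_commutatorElement, commutatorElement_eq_one_iff_mul_comm] at this
    exact this.symm
  have hPn : P.Normal := by
    have : (Subgroup.zpowers (QuotientGroup.mk' Γ ⁅a, b⁆)).Normal := ⟨by
      rintro _ ⟨k, rfl⟩ g
      have h1 := zpow_mem (hcen _ (commutatorElement_mem_commutator a b)) k
      have h2 : g * (QuotientGroup.mk' Γ ⁅a, b⁆) ^ k * g⁻¹ = (QuotientGroup.mk' Γ ⁅a, b⁆) ^ k := by
        rw [Subgroup.mem_center_iff.1 h1 g, mul_inv_cancel_right]
      exact ⟨k, h2.symm⟩⟩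
    exact this.comap _
  have hPab : ⁅a, b⁆ ∈ P := Subgroup.mem_zpowers _
  have htop : ∀ K : Subgroup E, a ∈ K → b ∈ K → ρ.ker ≤ K → K = ⊤ := fun K ha hb hK => by
    have h1 : K.map ρ = ⊤ := by
      rw [eq_top_iff, ← hgen, Subgroup.closure_le]
      rintro x (rfl | rfl)
      · exact ⟨a, ha, rfl⟩
      · exact ⟨b, hb, rfl⟩
    rw [← Subgroup.comap_map_eq_self hK, h1, Subgroup.comap_top]
  let q := QuotientGroup.mk' P
  have hqk : ∀ n ∈ ρ.ker, q n ∈ Subgroup.center (E ⧸ P) := fun n hn => by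
    rw [Subgroup.mem_center_iff]
    intro x
    obtain ⟨x, rfl⟩ := QuotientGroup.mk'_surjective _ x
    exact (map_mul q _ _).symm.trans
      ((congrArg q (Subgroup.mem_center_iff.1 (hc hn) x)).trans (map_mul q _ _))
  have hqab : Commute (q a) (q b) := by
    rw [← commutatorElement_eq_one_iff_commute, ← map_commutatorElement]
    exact (QuotientGroup.eq_one_iff _).2 hPab
  have hqcen : ∀ y, Commute (q a) y → Commute (q b) y → y ∈ Subgroup.center (E ⧸ P) := by
    intro y hay hby
    have h1 := htop ((Subgroup.centralizer {y}).comap q)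
      (Subgroup.mem_centralizer_singleton_iff.2 hay)
      (Subgroup.mem_centralizer_singleton_iff.2 hby)
      (fun n hn => Subgroup.mem_centralizer_singleton_iff.2
        (Subgroup.mem_center_iff.1 (hqk n hn) y).symm)
    rw [Subgroup.mem_center_iff]
    intro x
    obtain ⟨x, rfl⟩ := QuotientGroup.mk'_surjective _ x
    have h2 : x ∈ (Subgroup.centralizer {y}).comap q := h1 ▸ Subgroup.mem_top x
    exact Subgroup.mem_centralizer_singleton_iff.1 h2
  have hall := htop ((Subgroup.center _).comap q) (hqcen _ (Commute.refl _) hqab.symm)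
    (hqcen _ hqab (Commute.refl _)) hqk
  have hcP : commutator E ≤ P := by
    rw [commutator_def, Subgroup.commutator_le]
    intro x _ y _
    rw [← QuotientGroup.eq_one_iff]
    change q ⁅x, y⁆ = 1
    rw [map_commutatorElement, commutatorElement_eq_one_iff_mul_comm]
    have h2 : y ∈ (Subgroup.center _).comap q := hall ▸ Subgroup.mem_top y
    exact Subgroup.mem_center_iff.1 h2 _
  obtain ⟨k, hk⟩ := hcP hm
  have hk' : (⁅a, b⁆ ^ k)⁻¹ * m ∈ Γ := QuotientGroup.eq.1 ((map_zpow _ _ _).trans hk)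
  -- As `m` lies in the kernel, `ρ ⁅a, b⁆ ^ k = 1`; this element has order `p`, so `p` divides `k`,
  -- and `⁅a, b⁆ ^ p = 1` already in `E`.
  suffices h1 : ⁅a, b⁆ ^ k = 1 by simpa [h1] using hk'
  have h2 := hΓ hk'
  rw [MonoidHom.mem_ker, map_mul, map_inv, MonoidHom.mem_ker.1 hmk, mul_one, inv_eq_one,
    map_zpow, ← orderOf_dvd_iff_zpow_eq_one, orderOf_eq_prime (hexp _) hab] at h2
  obtain ⟨j, rfl⟩ := h2
  rw [zpow_mul, zpow_natCast, pow_eq_one_of_mem_commutator_of_central hp hodd hc hG hexp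
    (commutatorElement_mem_commutator _ _), one_zpow]

/-- A commutator `⁅d, x⁆` with `d` in the derived subgroup depends only on `d` modulo the kernel and
multiplicatively on `x` modulo the derived subgroup; `α` fixes the former class and inverts the
latter. -/
theorem apply_eq_inv_of_mem_triple_commutator (hc : ρ.ker ≤ Subgroup.center E)
    (hG : commutator G ≤ Subgroup.center G) {α : E →* E} (hα : ∀ x, α x * x ∈ commutator E)
    {m : E} (hm : m ∈ ⁅commutator E, (⊤ : Subgroup E)⁆) : α m = m⁻¹ := by
  have hΓ : ⁅commutator E, (⊤ : Subgroup E)⁆ ≤ Subgroup.center E :=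
    Subgroup.commutator_le.2 fun d hd x _ => hc (commutatorElement_mem_ker hG hd x)
  have key : ∀ d ∈ commutator E, ∀ x, α ⁅d, x⁆ = ⁅d, x⁆⁻¹ := fun d hd x => by
    have hcen : ∀ x, ⁅d, x⁆ ∈ Subgroup.center E := fun x => hc (commutatorElement_mem_ker hG hd x)
    have h1 : ρ (α d) = ρ d := eqOn_commutator_of_mul_mem_center hG ρ (ρ.comp α)
      (fun x => hG (map_commutator_le ρ ⟨_, hα x, by simp⟩)) hd
    have h2 : d⁻¹ * α d ∈ Subgroup.center E := hc (by
      rw [MonoidHom.mem_ker, map_mul, map_inv, h1, inv_mul_cancel])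
    have h3 : α d = d * (d⁻¹ * α d) := by group
    have h4 : α x = (α x * x) * x⁻¹ * 1 := by group
    have h5 : ⁅d, α x * x * x⁻¹⁆ = ⁅d, α x * x⁆ * ⁅d, x⁆⁻¹ :=
      ((commutatorLeftHom d hcen).map_mul _ _).trans
        (congrArg _ ((commutatorLeftHom d hcen).map_inv x))
    rw [map_commutatorElement, h3, h4, commutatorElement_mul_center h2 (one_mem _), h5,
      commutatorElement_eq_one_of_mem_commutator hc hG hd (hα x), one_mul]
  have hm' := hm
  rw [Subgroup.commutator_def] at hm'
  induction hm' using Subgroup.closure_induction with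
  | mem x hx => obtain ⟨d, hd, y, -, rfl⟩ := hx; exact key d hd y
  | one => simp
  | mul x y hx hy ihx ihy =>
    rw [← Subgroup.commutator_def] at hx hy
    rw [map_mul, ihx hx, ihy hy, mul_inv_rev]
    exact (Subgroup.mem_center_iff.1 (inv_mem (hΓ hx)) _).symm
  | inv x hx ihx =>
    rw [← Subgroup.commutator_def] at hx
    rw [map_inv, ihx hx]

theorem AddMonoidHom.exists_extension_of_zmod [Fact p.Prime] {V M : Type*} [AddCommGroup V]
    [Module (ZMod p) V] [AddCommGroup M] [Module (ZMod p) M] (R : AddSubgroup V) (δ : R →+ M) :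
    ∃ T : V →+ M, ∀ r : R, T r = δ r := by
  let W : Submodule (ZMod p) V := AddSubgroup.toZModSubmodule p R
  let L : W →+ M := δ
  obtain ⟨T, hT⟩ := LinearMap.exists_extend (L.toZModLinearMap p)
  exact ⟨T.toAddMonoidHom, fun r => LinearMap.congr_fun hT r⟩

/-- A homomorphism from a subgroup to an elementary abelian group extends if it kills the elements
that are `p`-th powers modulo commutators. -/
theorem exists_extension_of_pow_mul (hp : p.Prime) {M : Type w} [CommGroup M]
    (hM : ∀ m : M, m ^ p = 1) (N : Subgroup E) (δ : N →* M)
    (hδ : ∀ (n : N) (x : E), x⁻¹ ^ p * (n : E) ∈ commutator E → δ n = 1) :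
    ∃ θ : E →* M, ∀ n : N, θ n = δ n := by
  have := Fact.mk hp
  let A := Abelianization E
  let V := Additive (A ⧸ (powMonoidHom p : A →* A).range)
  let _ : AddCommGroup V :=
    inferInstanceAs (AddCommGroup (Additive (A ⧸ (powMonoidHom p : A →* A).range)))
  let _ : Module (ZMod p) V := AddCommGroup.zmodModule fun x => by
    obtain ⟨y, rfl⟩ := QuotientGroup.mk'_surjective _ (x : A ⧸ (powMonoidHom p : A →* A).range)
    exact (QuotientGroup.eq_one_iff (y ^ p)).2 ⟨y, rfl⟩
  let M' := Additive M
  let _ : AddCommGroup M' := inferInstanceAs (AddCommGroup (Additive M))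
  let _ : Module (ZMod p) M' := AddCommGroup.zmodModule fun x => hM x
  let v : E →* Multiplicative V :=
    ((QuotientGroup.mk' (powMonoidHom p : A →* A).range).comp Abelianization.of :
      E →* A ⧸ (powMonoidHom p : A →* A).range)
  have hv : ∀ n : N, v n = 1 → δ n = 1 := fun n hn => by
    obtain ⟨y, hy⟩ := (QuotientGroup.eq_one_iff (Abelianization.of (n : E))).1 hn
    obtain ⟨x, rfl⟩ := QuotientGroup.mk_surjective y
    refine hδ n x ?_
    rw [← Abelianization.ker_of, MonoidHom.mem_ker, map_mul, map_pow, map_inv, ← hy]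
    change (Abelianization.of x)⁻¹ ^ p * (Abelianization.of x) ^ p = 1
    rw [inv_pow, inv_mul_cancel]
  let r := (v.comp N.subtype).rangeRestrict
  have hr : Function.Surjective r := MonoidHom.rangeRestrict_surjective _
  let δ' : (v.comp N.subtype).range →* M := r.liftOfRightInverse _ (Function.rightInverse_surjInv hr)
    ⟨δ, fun n hn => hv n (congrArg Subtype.val hn)⟩
  have hδ' : ∀ n, δ' (r n) = δ n := fun n =>
    MonoidHom.liftOfRightInverse_comp_apply _ _ _ _ _
  obtain ⟨T, hT⟩ := AddMonoidHom.exists_extension_of_zmod (p := p) (V := V) (M := M')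
    (Subgroup.toAddSubgroup' (v.comp N.subtype).range)
    (AddMonoidHom.mk' (M := Subgroup.toAddSubgroup' (v.comp N.subtype).range)
      (fun w => Additive.ofMul (δ' ⟨Multiplicative.ofAdd w.1, w.2⟩)) fun w w' =>
        congrArg Additive.ofMul (map_mul δ' ⟨Multiplicative.ofAdd w.1, w.2⟩
          ⟨Multiplicative.ofAdd w'.1, w'.2⟩))
  refine ⟨(AddMonoidHom.toMultiplicative T).comp v, fun n => ?_⟩
  exact (hT ⟨(v n).toAdd, n, rfl⟩).trans (hδ' n)

/-- An endomorphism of a central extension that inverts the abelianisation and the commutators in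
the kernel can be modified so as to invert the whole kernel. -/
theorem exists_hom_inverting_ker (hp : p.Prime) (hodd : Odd p)
    (hc : ρ.ker ≤ Subgroup.center E) (hG : commutator G ≤ Subgroup.center G)
    (hexp : ∀ x : G, x ^ p = 1) {α : E →* E} (hα : ∀ x, α x * x ∈ commutator E)
    (hαk : ∀ n ∈ ρ.ker, α n ∈ ρ.ker)
    (hinv : ∀ m ∈ ρ.ker, m ∈ commutator E → α m = m⁻¹) :
    ∃ β : E →* E, (∀ x, β x * x ∈ commutator E) ∧ ∀ n ∈ ρ.ker, β n = n⁻¹ := by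
  have hcom : ∀ n ∈ ρ.ker, ∀ x, Commute n x := fun n hn x =>
    (Subgroup.mem_center_iff.1 (hc hn) x).symm
  let M : Subgroup E := ρ.ker ⊓ commutator E
  let _ : CommGroup M := { (inferInstance : Group M) with
    mul_comm := fun a b => Subtype.ext (hcom a a.2.1 b) }
  -- `δ` measures the failure of `α` to invert the kernel, and takes values in the central
  -- elementary abelian group `M`.
  let δ : ρ.ker →* M := MonoidHom.mk' (fun n => ⟨α n * n, mul_mem (hαk n n.2) n.2, hα n⟩)
    fun n n' => Subtype.ext (by
      change α (n * n') * (n * n') = α n * n * (α n' * n')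
      rw [map_mul]
      calc _ = α n * (α n' * n) * n' := by group
        _ = _ := by rw [← (hcom n n.2 (α n')).eq]; group)
  obtain ⟨θ, hθ⟩ := exists_extension_of_pow_mul hp (M := M)
    (fun m => Subtype.ext (pow_eq_one_of_mem_commutator_of_central hp hodd hc hG hexp m.2.2))
    ρ.ker δ (fun n x hx => Subtype.ext (by
      change α n * n = 1
      -- If `n` is `x ^ p` modulo commutators, then `x⁻¹ ^ p * n` is inverted by hypothesis, and
      -- `x⁻¹ ^ p` is inverted because `α x⁻¹` is `x` times a commutator. Hence `n` is inverted,
      -- that is, `δ n = 1`.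
      have hxp : x⁻¹ ^ p ∈ ρ.ker := by rw [MonoidHom.mem_ker, map_pow, hexp]
      have h1 := hinv _ (mul_mem hxp n.2) hx
      have h2 : α x⁻¹ = x * (x⁻¹ * α x⁻¹) := by group
      have h3 : x⁻¹ * α x⁻¹ ∈ commutator E := mul_mem_comm_commutator (hα x⁻¹)
      have h4 : α (x⁻¹ ^ p) = x ^ p := by
        rw [map_pow, h2, mul_pow_of_mem_commutator hp hodd hc hG hexp x h3,
          pow_eq_one_of_mem_commutator_of_central hp hodd hc hG hexp h3, mul_one]
      rw [map_mul, h4, mul_inv_rev, inv_pow, inv_inv, (hcom _ (inv_mem n.2) _).eq] at h1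
      rw [mul_left_cancel h1, inv_mul_cancel]))
  refine ⟨MonoidHom.mk' (fun x => α x * (θ x : E)⁻¹) fun x y => ?_, fun x => ?_, fun n hn => ?_⟩
  · rw [map_mul, map_mul, Subgroup.coe_mul, mul_inv_rev]
    have h1 := (hcom _ (inv_mem (θ x).2.1) (α y * (θ y : E)⁻¹)).eq
    calc _ = α x * ((α y * (θ y : E)⁻¹) * (θ x : E)⁻¹) := by group
      _ = _ := by rw [← h1]; group
  · change α x * (θ x : E)⁻¹ * x ∈ _
    rw [mul_assoc, (hcom _ (inv_mem (θ x).2.1) x).eq, ← mul_assoc]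
    exact mul_mem (hα x) (inv_mem (θ x).2.2)
  · change α n * (θ n : E)⁻¹ = n⁻¹
    rw [hθ ⟨n, hn⟩]
    change α n * (α n * n)⁻¹ = n⁻¹
    rw [mul_inv_rev, ← mul_assoc, ((hcom n hn (α n)).inv_left).symm.eq, mul_inv_cancel_right]

end CentralExtension

/-! ### An endomorphism of F inverting F/F' and N/[N,F] -/

namespace IsExtraSpecial

open scoped commutatorElement

variable {p : ℕ} {G : Type u} [Group G]

theorem exists_free_inversion (hp : p.Prime) (hodd : Odd p) (hG : IsExtraSpecial p G)
    (hcard : Nat.card G = p ^ 3) (hexp : ∀ x : G, x ^ p = 1) {ι : Type w} {π : FreeGroup ι →* G}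
    (hπ : Function.Surjective π) :
    ∃ β : FreeGroup ι →* FreeGroup ι, (∀ x, β x * x ∈ commutator (FreeGroup ι)) ∧
      ∀ n ∈ π.ker, β n * n ∈ ⁅π.ker, (⊤ : Subgroup (FreeGroup ι))⁆ := by
  have hc2 := hG.commutator_le_center
  obtain ⟨σ, hσ⟩ := hG.exists_hom_mul_mem_commutator hp hcard hexp
  have hmap : (commutator (FreeGroup ι)).map π = commutator G := by
    rw [commutator_def, commutator_def, Subgroup.map_commutator,
      ← MonoidHom.range_eq_map, MonoidHom.range_eq_top.2 hπ]
  -- The commutator subgroup of the free group maps onto that of `G`, so a lift of `σ` on a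
  -- generator can be chosen to invert it modulo commutators.
  have hgen : ∀ i : ι, ∃ f : FreeGroup ι, f * FreeGroup.of i ∈ commutator (FreeGroup ι) ∧
      π f = σ (π (FreeGroup.of i)) := fun i => by
    obtain ⟨d, hd, hd'⟩ : σ (π (FreeGroup.of i)) * π (FreeGroup.of i) ∈
      (commutator (FreeGroup ι)).map π := hmap ▸ hσ _
    exact ⟨d * (FreeGroup.of i)⁻¹, by simpa using hd, by rw [map_mul, hd', map_inv]; group⟩
  choose g hg1 hg2 using hgen
  have hAb : ∀ {K : Type w} [Group K] {x y : K},
      Abelianization.of x = (Abelianization.of y)⁻¹ ↔ x * y ∈ commutator K := fun {K _ x y} => by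
    rw [← Abelianization.ker_of, MonoidHom.mem_ker, map_mul, ← eq_inv_iff_mul_eq_one]
  let β₀ : FreeGroup ι →* FreeGroup ι := FreeGroup.lift g
  have hβ₀ : ∀ x, β₀ x * x ∈ commutator (FreeGroup ι) := fun x => hAb.1
    (DFunLike.congr_fun (FreeGroup.ext_hom (Abelianization.of.comp β₀)
      (Abelianization.of (G := FreeGroup ι))⁻¹ fun i => by
        simpa [β₀] using hAb.2 (hg1 i)) x)
  have hβ₀π : ∀ x, π (β₀ x) = σ (π x) := DFunLike.congr_fun
    (FreeGroup.ext_hom (π.comp β₀) (σ.comp π) fun i => by simpa [β₀] using hg2 i)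
  set R := ⁅π.ker, (⊤ : Subgroup (FreeGroup ι))⁆ with hR
  have hRker : R ≤ π.ker := Subgroup.commutator_le_left _ _
  have hRcomm : R ≤ commutator (FreeGroup ι) := Subgroup.commutator_mono le_top le_top
  have hRβ : R ≤ R.comap β₀ := Subgroup.commutator_le.2 fun n hn f _ => by
    rw [Subgroup.mem_comap, map_commutatorElement]
    refine Subgroup.commutator_mem_commutator ?_ (Subgroup.mem_top _)
    rw [MonoidHom.mem_ker, hβ₀π, MonoidHom.mem_ker.1 hn, map_one]
  let q := QuotientGroup.mk' R
  have hq : Function.Surjective q := QuotientGroup.mk'_surjective R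
  let ρ : FreeGroup ι ⧸ R →* G := QuotientGroup.lift R π hRker
  have hρ : ∀ x, ρ (q x) = π x := fun x => rfl
  have hker : ρ.ker ≤ Subgroup.center _ := by
    intro n hn
    rw [Subgroup.mem_center_iff]
    intro x
    obtain ⟨n, rfl⟩ := hq n
    obtain ⟨x, rfl⟩ := hq x
    have : q ⁅n, x⁆ = 1 := (QuotientGroup.eq_one_iff _).2
      (Subgroup.commutator_mem_commutator hn (Subgroup.mem_top _))
    rw [map_commutatorElement, commutatorElement_eq_one_iff_mul_comm] at this
    exact this.symm
  let α₀ : FreeGroup ι ⧸ R →* FreeGroup ι ⧸ R := QuotientGroup.map R R β₀ hRβ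
  have hα₀ : ∀ x, α₀ x * x ∈ commutator (FreeGroup ι ⧸ R) := fun x => by
    obtain ⟨x, rfl⟩ := hq x
    exact map_commutator_le q ⟨_, hβ₀ x, map_mul q _ _⟩
  have hα₀ρ : ∀ n ∈ ρ.ker, α₀ n ∈ ρ.ker := fun n hn => by
    obtain ⟨n, rfl⟩ := hq n
    change π (β₀ n) = 1
    rw [hβ₀π, show π n = 1 from hn, map_one]
  obtain ⟨a, b, hab⟩ := hG.not_commute hp
  obtain ⟨a, rfl⟩ := hπ a
  obtain ⟨b, rfl⟩ := hπ b
  have hab' : ρ ⁅q a, q b⁆ ≠ 1 := fun h => hab (commutatorElement_eq_one_iff_commute.1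
    ((map_commutatorElement ρ _ _).symm.trans h))
  obtain ⟨α, hα, hαinv⟩ := exists_hom_inverting_ker hp hodd hker hc2 hexp hα₀ hα₀ρ
    fun m hmk hm => apply_eq_inv_of_mem_triple_commutator hker hc2 hα₀
      (mem_triple_commutator hp hodd hker hc2 hexp (a := q a) (b := q b)
        (closure_pair_eq_top hp hcard hab) hab' hm hmk)
  have hlift : ∀ i : ι, ∃ f, q f = α (q (FreeGroup.of i)) := fun i => hq _
  choose f hf using hlift
  have hβ : ∀ x, q (FreeGroup.lift f x) = α (q x) := DFunLike.congr_fun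
    (FreeGroup.ext_hom (q.comp (FreeGroup.lift f)) (α.comp q) fun i => by simpa using hf i)
  -- Since `R` lies in the commutator subgroup, inversion of the abelianisation passes back from the
  -- quotient by `R` to the free group.
  refine ⟨FreeGroup.lift f, fun x => ?_, fun n hn => ?_⟩
  · have h1 : q (FreeGroup.lift f x * x) ∈ (commutator (FreeGroup ι)).map q := by
      rw [map_mul, hβ, commutator_def, Subgroup.map_commutator, ← MonoidHom.range_eq_map,
        MonoidHom.range_eq_top.2 hq]
      exact hα (q x)
    obtain ⟨d, hd, hd'⟩ := h1
    have h2 := hRcomm (QuotientGroup.eq.1 hd')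
    have h3 := mul_mem hd h2
    rwa [mul_inv_cancel_left] at h3
  · rw [← QuotientGroup.eq_one_iff]
    change q (FreeGroup.lift f n * n) = 1
    rw [map_mul, hβ, hαinv (q n) hn, inv_mul_cancel]

end IsExtraSpecial

/-! ### Commutator calculus in τ(G) -/

section Tensor

variable {p : ℕ} {G : Type u} [Group G]

theorem conj'_mul {G : Type*} [Group G] (x y z : G) : conj' (x * y) z = conj' x z * conj' y z := by
  simp only [conj']; group

theorem conj'_mul_right {G : Type*} [Group G] (x y z : G) :
    conj' x (y * z) = conj' (conj' x y) z := by
  simp only [conj']; group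

theorem conj'_eq_iff_commute {G : Type*} [Group G] {x z : G} : conj' x z = x ↔ Commute x z := by
  rw [conj', mul_assoc, inv_mul_eq_iff_eq_mul]; rfl

theorem comm'_eq_one_iff {G : Type*} [Group G] {x y : G} : comm' x y = 1 ↔ Commute x y := by
  rw [comm', mul_assoc, ← mul_inv_rev, inv_mul_eq_one, eq_comm]; rfl

theorem conj'_eq_mul_comm' {G : Type*} [Group G] (x z : G) : conj' x z = x * comm' x z := by
  simp only [conj', comm']; group

theorem map_conj' {G H : Type*} [Group G] [Group H] (f : G →* H) (x z : G) :
    f (conj' x z) = conj' (f x) (f z) := by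
  simp [conj']

theorem map_comm' {G H : Type*} [Group G] [Group H] (f : G →* H) (x z : G) :
    f (comm' x z) = comm' (f x) (f z) := by
  simp [comm']

/-- Two homomorphisms satisfying the defining relations of `τ(G)`. -/
structure TauPair (G : Type u) [Group G] (T : Type v) [Group T] where
  X : G →* T
  Y : G →* T
  conj_X : ∀ x y z, conj' (comm' (X x) (Y y)) (X z) = comm' (X (conj' x z)) (Y (conj' y z))
  conj_Y : ∀ x y z, conj' (comm' (X x) (Y y)) (Y z) = comm' (X (conj' x z)) (Y (conj' y z))
  comm_self : ∀ x, comm' (X x) (Y x) = 1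

namespace TauPair

variable {T : Type v} [Group T] (P : TauPair G T)

/-- The commutator `[x, y*]`. -/
def t (x y : G) : T := comm' (P.X x) (P.Y y)

theorem conj_t_X (x y z : G) : conj' (P.t x y) (P.X z) = P.t (conj' x z) (conj' y z) :=
  P.conj_X x y z

theorem conj_t_Y (x y z : G) : conj' (P.t x y) (P.Y z) = conj' (P.t x y) (P.X z) :=
  (P.conj_Y x y z).trans (P.conj_X x y z).symm

theorem t_self (x : G) : P.t x x = 1 := P.comm_self x

theorem t_mul_left (x x' y : G) : P.t (x * x') y = conj' (P.t x y) (P.X x') * P.t x' y := by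
  simp only [t, comm', conj', map_mul]; group

theorem t_mul_right (x y y' : G) : P.t x (y * y') = P.t x y' * conj' (P.t x y) (P.X y') := by
  rw [← conj_t_Y]
  simp only [t, comm', conj', map_mul]; group

/-- Expanding `t (x * y) (x * y) = 1` leaves a conjugate of `t x y * t y x`. -/
theorem t_swap (x y : G) : P.t y x = (P.t x y)⁻¹ := by
  have h := P.t_self (x * y)
  rw [t_mul_left, t_mul_right, t_mul_right, t_self, t_self, one_mul] at h
  rw [show conj' 1 (P.X y) = 1 by simp [conj'], mul_one, ← conj'_mul] at h
  have h1 : P.t x y * P.t y x = 1 := by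
    rw [conj', mul_assoc, inv_mul_eq_one] at h
    exact (mul_eq_right.1 h.symm)
  exact eq_inv_of_mul_eq_one_right h1

theorem t_one_left (y : G) : P.t 1 y = 1 := by simp [t, comm']

theorem conj_t_central {z : G} (hz : z ∈ Subgroup.center G) (x y : G) :
    conj' (P.t x y) (P.X z) = P.t x y := by
  have h : ∀ x, conj' x z = x := fun x => conj'_eq_iff_commute.2 (Subgroup.mem_center_iff.1 hz x)
  rw [conj_t_X, h, h]

theorem t_central_central {c : G} (hc : Subgroup.center G ≤ Subgroup.zpowers c) {z z' : G}
    (hz : z ∈ Subgroup.center G) (hz' : z' ∈ Subgroup.center G) : P.t z z' = 1 := by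
  obtain ⟨i, rfl⟩ := hc hz
  obtain ⟨j, rfl⟩ := hc hz'
  have h : Commute (P.X c) (P.Y c) := comm'_eq_one_iff.1 (P.comm_self c)
  refine comm'_eq_one_iff.2 ?_
  simp only [map_zpow]
  exact (h.zpow_left i).zpow_right j

theorem comm'_mem_center (hG : commutator G ≤ Subgroup.center G) (x y : G) :
    comm' x y ∈ Subgroup.center G := by
  have := hG (commutatorElement_mem_commutator x⁻¹ y⁻¹)
  simpa [comm', commutatorElement_def] using this

/-- `X z` and `Y z` act alike on the symbols `t x y`, so conjugation by `t z w` is the action of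
`comm' z w`, which is central in `G` and acts trivially. -/
theorem commute_t_t (hG : commutator G ≤ Subgroup.center G) (x y z w : G) :
    Commute (P.t x y) (P.t z w) := by
  rw [← conj'_eq_iff_commute, t.eq_def P z w, comm', ← map_inv, ← map_inv]
  simp only [conj'_mul_right, conj_t_X, conj_t_Y]
  simp only [← conj'_mul_right]
  have h : ∀ x, conj' x (z⁻¹ * w⁻¹ * z * w) = x := fun x =>
    conj'_eq_iff_commute.2 (Subgroup.mem_center_iff.1 (comm'_mem_center hG z w) x)
  rw [h, h]

theorem conj_t_of_central_right (hG : commutator G ≤ Subgroup.center G) {c : G}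
    (hc : Subgroup.center G ≤ Subgroup.zpowers c) {z : G} (hz : z ∈ Subgroup.center G) (x w : G) :
    conj' (P.t x z) (P.X w) = P.t x z := by
  have h : conj' z w = z := conj'_eq_iff_commute.2 (Subgroup.mem_center_iff.1 hz w).symm
  have hk := comm'_mem_center hG x w
  rw [conj_t_X, h, conj'_eq_mul_comm', t_mul_left, P.conj_t_central hk,
    P.t_central_central hc hk hz, mul_one]

theorem t_central_mul (hG : commutator G ≤ Subgroup.center G) {c : G}
    (hc : Subgroup.center G ≤ Subgroup.zpowers c) {z : G} (hz : z ∈ Subgroup.center G) (x y : G) :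
    P.t (x * y) z = P.t x z * P.t y z := by
  rw [t_mul_left, P.conj_t_of_central_right hG hc hz]

theorem t_central_pow (hG : commutator G ≤ Subgroup.center G) {c : G}
    (hc : Subgroup.center G ≤ Subgroup.zpowers c) {z : G} (hz : z ∈ Subgroup.center G) (x : G)
    (n : ℕ) : P.t (x ^ n) z = P.t x z ^ n := by
  induction n with
  | zero => simp [t_one_left]
  | succ n ih => rw [pow_succ, P.t_central_mul hG hc hz, ih, pow_succ]

theorem t_mul_central (x : G) {z z' : G} (hz' : z' ∈ Subgroup.center G) :
    P.t x (z * z') = P.t x z' * P.t x z := by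
  rw [t_mul_right, P.conj_t_central hz']

/-- `X x * t x y` is the conjugate of `X x` by `Y y`, so its `p`-th power is 1. The product formula
applies with correction term `t x (comm' y x)`, which is itself killed by `p`. -/
theorem t_pow_eq_one (hp : p.Prime) (hodd : Odd p) (hG : commutator G ≤ Subgroup.center G) {c : G}
    (hc : Subgroup.center G ≤ Subgroup.zpowers c) (hexp : ∀ x : G, x ^ p = 1) (x y : G) :
    P.t x y ^ p = 1 := by
  have hcen : ∀ (x : G) {z : G}, z ∈ Subgroup.center G → P.t x z ^ p = 1 := fun x z hz => by
    rw [← P.t_central_pow hG hc hz, hexp, t_one_left]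
  have hk := comm'_mem_center hG y x
  have h1 : (P.X x * P.t x y) ^ p = P.X x ^ p * P.t x y ^ p := by
    refine mul_pow_of_comm'_pow_eq_one hp hodd (e := P.t x (comm' y x)) ?_ ?_
      (P.commute_t_t hG _ _ _ _) (hcen x hk)
    · have h2 : conj' (P.t x y) (P.X x) = P.t x (comm' y x) * P.t x y := by
        rw [conj_t_X, conj'_eq_mul_comm' y, P.t_mul_central _ hk]
        simp [conj']
      rw [(P.commute_t_t hG _ _ _ _).eq] at h2
      rw [mul_assoc, ← h2]
      simp only [conj']; group
    · exact conj'_eq_iff_commute.1 (P.conj_t_of_central_right hG hc hk x x)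
  have h3 : P.X x * P.t x y = (P.Y y)⁻¹ * P.X x * P.Y y := by
    simp only [t, comm']; group
  have h4 : ((P.Y y)⁻¹ * P.X x * P.Y y) ^ p = 1 := by
    have := conj_pow (a := (P.Y y)⁻¹) (b := P.X x) (i := p)
    rw [inv_inv] at this
    rw [this, ← map_pow, hexp, map_one]; group
  rw [h3, h4, ← map_pow, hexp, map_one, one_mul] at h1
  exact h1.symm

/-- The subgroup of products of three basic commutators. -/
def basicSubgroup (a b c : G) : Subgroup T := Subgroup.closure {P.t a b, P.t a c, P.t b c}

theorem exists_zpow_of_mem_basicSubgroup (hG : commutator G ≤ Subgroup.center G) {a b c : G} {w : T}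
    (hw : w ∈ P.basicSubgroup a b c) :
    ∃ i j k : ℤ, w = P.t a b ^ i * P.t a c ^ j * P.t b c ^ k := by
  have h := P.commute_t_t hG
  induction hw using Subgroup.closure_induction with
  | mem x hx =>
    rcases hx with rfl | rfl | rfl
    · exact ⟨1, 0, 0, by simp⟩
    · exact ⟨0, 1, 0, by simp⟩
    · exact ⟨0, 0, 1, by simp⟩
  | one => exact ⟨0, 0, 0, by simp⟩
  | mul x y _ _ hx hy =>
    obtain ⟨i, j, k, rfl⟩ := hx
    obtain ⟨i', j', k', rfl⟩ := hy
    refine ⟨i + i', j + j', k + k', ?_⟩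
    have h1 := ((h b c a b).zpow_zpow k i').eq
    have h2 := ((h b c a c).zpow_zpow k j').eq
    have h3 := ((h a c a b).zpow_zpow j i').eq
    calc _ = P.t a b ^ i * P.t a c ^ j * (P.t b c ^ k * P.t a b ^ i') * P.t a c ^ j' *
          P.t b c ^ k' := by group
      _ = P.t a b ^ i * (P.t a c ^ j * P.t a b ^ i') * (P.t b c ^ k * P.t a c ^ j') *
          P.t b c ^ k' := by rw [h1]; group
      _ = _ := by rw [h2, h3, zpow_add, zpow_add, zpow_add]; group
  | inv x _ hx =>
    obtain ⟨i, j, k, rfl⟩ := hx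
    refine ⟨-i, -j, -k, ?_⟩
    have h1 := ((h b c a b).zpow_zpow (-k) (-i)).eq
    have h2 := ((h b c a c).zpow_zpow (-k) (-j)).eq
    have h3 := ((h a c a b).zpow_zpow (-j) (-i)).eq
    rw [mul_inv_rev, mul_inv_rev, ← zpow_neg, ← zpow_neg, ← zpow_neg, h3, ← mul_assoc, h1, mul_assoc,
      h2, ← mul_assoc]

section Generation

variable {a b c : G}

theorem t_mem_of_central (hcc : c ∈ Subgroup.center G)
    (hc : Subgroup.center G ≤ Subgroup.zpowers c) {z : G} (hz : z ∈ Subgroup.center G) {x : G}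
    {S : Subgroup T} (hx : P.t x c ∈ S) : P.t x z ∈ S := by
  have hfin : ∀ n : ℤ, P.t x (c ^ n) = P.t x c ^ n := fun n => by
    -- The opposite group absorbs the reversed order of factors in `t_mul_central`.
    let f : Subgroup.center G →* Tᵐᵒᵖ := MonoidHom.mk' (fun z => MulOpposite.op (P.t x z))
      fun z z' => by
        rw [← MulOpposite.op_mul, ← P.t_mul_central x z'.2]; rfl
    exact MulOpposite.op_injective (map_zpow f ⟨c, hcc⟩ n)
  obtain ⟨n, rfl⟩ := hc hz
  change P.t x (c ^ n) ∈ S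
  rw [hfin]
  exact zpow_mem hx n

theorem conj_mem_basicSubgroup (hG : commutator G ≤ Subgroup.center G)
    (hc : Subgroup.center G ≤ Subgroup.zpowers c) (hcc : c ∈ Subgroup.center G) {w : T}
    (hw : w ∈ P.basicSubgroup a b c) (g : G) :
    conj' w (P.X g) ∈ P.basicSubgroup a b c ∧ conj' w (P.Y g) = conj' w (P.X g) := by
  have hac : P.t a c ∈ P.basicSubgroup a b c := Subgroup.subset_closure (by simp)
  have hbc : P.t b c ∈ P.basicSubgroup a b c := Subgroup.subset_closure (by simp)
  induction hw using Subgroup.closure_induction with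
  | mem x hx =>
    rcases hx with rfl | rfl | rfl
    · refine ⟨?_, P.conj_t_Y _ _ _⟩
      have hk := comm'_mem_center hG a g
      have hk' := comm'_mem_center hG b g
      rw [conj_t_X, conj'_eq_mul_comm', conj'_eq_mul_comm', t_mul_left, P.conj_t_central hk,
        P.t_mul_central _ hk', P.t_mul_central _ hk', P.t_central_central hc hk hk', one_mul,
        P.t_swap b (comm' a g)]
      exact mul_mem (mul_mem (P.t_mem_of_central hcc hc hk' hac)
        (Subgroup.subset_closure (by simp))) (inv_mem (P.t_mem_of_central hcc hc hk hbc))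
    · exact ⟨by rwa [P.conj_t_of_central_right hG hc hcc], P.conj_t_Y _ _ _⟩
    · exact ⟨by rwa [P.conj_t_of_central_right hG hc hcc], P.conj_t_Y _ _ _⟩
  | one => simp [conj']
  | mul x y _ _ hx hy =>
    rw [conj'_mul, conj'_mul, hx.2, hy.2]
    exact ⟨mul_mem hx.1 hy.1, rfl⟩
  | inv x _ hx =>
    have : ∀ g : T, conj' x⁻¹ g = (conj' x g)⁻¹ := fun g => by simp only [conj']; group
    rw [this, this, hx.2]
    exact ⟨inv_mem hx.1, rfl⟩

/-- The basic subgroup is stable under conjugation, so by the product rule the first argument may be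
taken to be `a` or `b`; antisymmetry then treats the second. -/
theorem t_mem_basicSubgroup (hG : commutator G ≤ Subgroup.center G)
    (hc : Subgroup.center G ≤ Subgroup.zpowers c) (hcc : c ∈ Subgroup.center G)
    (hab : Subgroup.closure {a, b} = ⊤) (x y : G) : P.t x y ∈ P.basicSubgroup a b c := by
  have hconj := fun {w} hw g => (P.conj_mem_basicSubgroup (a := a) (b := b) hG hc hcc (w := w) hw g).1
  have habS : P.t a b ∈ P.basicSubgroup a b c := Subgroup.subset_closure (by simp)
  have key : ∀ y, P.t a y ∈ P.basicSubgroup a b c → P.t b y ∈ P.basicSubgroup a b c →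
      ∀ x, P.t x y ∈ P.basicSubgroup a b c := by
    intro y ha hb x
    have hx : x ∈ Subgroup.closure {a, b} := hab ▸ Subgroup.mem_top x
    induction hx using Subgroup.closure_induction with
    | mem x hx => rcases hx with rfl | rfl <;> assumption
    | one => rw [t_one_left]; exact one_mem _
    | mul x x' _ _ hx hx' => rw [t_mul_left]; exact mul_mem (hconj hx _) hx'
    | inv x _ hx =>
      have h := P.t_mul_left x x⁻¹ y
      rw [mul_inv_cancel, t_one_left] at h
      rw [← inv_eq_of_mul_eq_one_right h.symm]
      exact inv_mem (hconj hx _)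
  have h1 := key b habS (by rw [t_self]; exact one_mem _)
  have h2 := key a (by rw [t_self]; exact one_mem _) (by rw [t_swap]; exact inv_mem habS)
  exact key y (by rw [t_swap]; exact inv_mem (h2 y)) (by rw [t_swap]; exact inv_mem (h1 y)) x

/-- Normal form for the elements of the group generated by a pair. -/
theorem exists_normal_form (hG : commutator G ≤ Subgroup.center G)
    (hc : Subgroup.center G ≤ Subgroup.zpowers c) (hcc : c ∈ Subgroup.center G)
    (hab : Subgroup.closure {a, b} = ⊤) {w : T} (hw : w ∈ P.X.range ⊔ P.Y.range) :
    ∃ e ∈ P.basicSubgroup a b c, ∃ g h : G, w = e * P.X g * P.Y h := by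
  have hconj := fun {w} hw g => P.conj_mem_basicSubgroup (a := a) (b := b) hG hc hcc (w := w) hw g
  have ht := P.t_mem_basicSubgroup hG hc hcc hab
  have hX : ∀ w, (∃ e ∈ P.basicSubgroup a b c, ∃ g h : G, w = e * P.X g * P.Y h) → ∀ x,
      ∃ e ∈ P.basicSubgroup a b c, ∃ g h : G, w * P.X x = e * P.X g * P.Y h := by
    rintro _ ⟨e, he, g, h, rfl⟩ x
    refine ⟨e * conj' (conj' (P.t x h⁻¹) (P.X x⁻¹)) (P.X g⁻¹),
      mul_mem he (hconj (hconj (ht _ _) _).1 _).1, g * x, h, ?_⟩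
    simp only [t, comm', conj', map_mul, map_inv]; group
  have hY : ∀ w, (∃ e ∈ P.basicSubgroup a b c, ∃ g h : G, w = e * P.X g * P.Y h) → ∀ x,
      ∃ e ∈ P.basicSubgroup a b c, ∃ g h : G, w * P.Y x = e * P.X g * P.Y h := by
    rintro _ ⟨e, he, g, h, rfl⟩ x
    exact ⟨e, he, g, h * x, by rw [map_mul, mul_assoc]⟩
  have hw' : w ∈ Subgroup.closure (P.X.range ∪ P.Y.range : Set T) := by
    rwa [Subgroup.closure_union, Subgroup.closure_eq, Subgroup.closure_eq]
  clear hw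
  induction hw' using Subgroup.closure_induction_right with
  | one => exact ⟨1, one_mem _, 1, 1, by simp⟩
  | mul_right x _ y hy ih =>
    rcases hy with ⟨g, rfl⟩ | ⟨g, rfl⟩
    · exact hX _ ih g
    · exact hY _ ih g
  | mul_inv_cancel x _ y hy ih =>
    rcases hy with ⟨g, rfl⟩ | ⟨g, rfl⟩
    · rw [← map_inv]; exact hX _ ih g⁻¹
    · rw [← map_inv]; exact hY _ ih g⁻¹

end Generation

end TauPair

end Tensor

/-! ### The denominator of K̃(G,3) and two embeddings -/

section Liedtke

open scoped commutatorElement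

variable {F : Type w} [Group F]

theorem mem_liedtkeK {x : Fin 3 → F} : x ∈ liedtkeK F 3 ↔ x 0 * x 1 * x 2 ∈ commutator F := by
  rw [← Abelianization.ker_of, MonoidHom.mem_ker, map_mul, map_mul, ← Fin.prod_univ_three
    (fun i => Abelianization.of (x i))]
  rfl

theorem mem_liedtkeKIn_of_mul_eq_one {N : Subgroup F} {x : Fin 3 → F} (hx : ∀ i, x i ∈ N)
    (h : x 0 * x 1 * x 2 = 1) : x ∈ liedtkeKIn N 3 := by
  refine ⟨fun i => ⟨x i, hx i⟩, mem_liedtkeK.2 ?_, rfl⟩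
  have : (⟨x 0, hx 0⟩ * ⟨x 1, hx 1⟩ * ⟨x 2, hx 2⟩ : N) = 1 := Subtype.ext h
  rw [this]
  exact one_mem _

/-- The right-hand side defines a normal subgroup because `N` is central modulo `⁅N, ⊤⁆`.
Conversely, `(⁅n, f⁆, 1, 1)` is the commutator of `(n, n⁻¹, 1)` and `(f, 1, 1)`, and splitting off
the product in the first coordinate leaves a triple of product 1. -/
theorem mem_normalClosure_liedtkeKIn {N : Subgroup F} [N.Normal] {x : Fin 3 → F} :
    x ∈ Subgroup.normalClosure (liedtkeKIn N 3 : Set (Fin 3 → F)) ↔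
      (∀ i, x i ∈ N) ∧ x 0 * x 1 * x 2 ∈ ⁅N, (⊤ : Subgroup F)⁆ := by
  set R := ⁅N, (⊤ : Subgroup F)⁆
  let q := QuotientGroup.mk' R
  have hq : ∀ {f : F}, q f = 1 ↔ f ∈ R := fun {f} => QuotientGroup.eq_one_iff f
  have hcom : ∀ n ∈ N, ∀ f, Commute (q n) (q f) := fun n hn f => by
    rw [← commutatorElement_eq_one_iff_commute, ← map_commutatorElement]
    exact hq.2 (Subgroup.commutator_mem_commutator hn (Subgroup.mem_top _))
  constructor
  · let S : Subgroup (Fin 3 → F) :=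
      { carrier := {x | (∀ i, x i ∈ N) ∧ x 0 * x 1 * x 2 ∈ R}
        one_mem' := ⟨fun _ => one_mem _, by simp [one_mem]⟩
        mul_mem' := by
          rintro x y ⟨hx, hx'⟩ ⟨hy, hy'⟩
          refine ⟨fun i => mul_mem (hx i) (hy i), ?_⟩
          rw [← hq] at hx' hy' ⊢
          simp only [Pi.mul_apply, map_mul] at hx' hy' ⊢
          have h1 := (hcom _ (hy 0) (x 1 * x 2)).eq
          have h2 := (hcom _ (hy 1) (x 2)).eq
          rw [map_mul] at h1
          calc _ = q (x 0) * (q (y 0) * q (x 1)) * (q (y 1) * q (x 2)) * q (y 2) := by group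
            _ = q (x 0) * (q (y 0) * (q (x 1) * q (x 2))) * q (y 1) * q (y 2) := by rw [h2]; group
            _ = (q (x 0) * q (x 1) * q (x 2)) * (q (y 0) * q (y 1) * q (y 2)) := by
              rw [h1]; group
            _ = 1 := by rw [hx', hy', one_mul]
        inv_mem' := by
          rintro x ⟨hx, hx'⟩
          refine ⟨fun i => inv_mem (hx i), ?_⟩
          rw [← hq] at hx' ⊢
          simp only [Pi.inv_apply, map_mul, map_inv] at hx' ⊢
          have h1 := (hcom _ (hx 0) (x 1)).eq
          have h2 := (hcom _ (hx 2) (x 1 * x 0)).eq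
          rw [map_mul] at h2
          rw [h1, ← h2] at hx'
          calc _ = (q (x 2) * (q (x 1) * q (x 0)))⁻¹ := by group
            _ = 1 := by rw [hx', inv_one] }
    have hS : S.Normal := ⟨by
      rintro x ⟨hx, hx'⟩ g
      refine ⟨fun i => (inferInstance : N.Normal).conj_mem _ (hx i) _, ?_⟩
      rw [← hq] at hx' ⊢
      have h : ∀ i, q ((g * x * g⁻¹) i) = q (x i) := fun i => by
        simp only [Pi.mul_apply, Pi.inv_apply, map_mul, map_inv]
        rw [← (hcom _ (hx i) (g i)).eq, mul_inv_cancel_right]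
      rw [map_mul, map_mul, h, h, h, ← map_mul, ← map_mul, hx']⟩
    have hle : Subgroup.normalClosure (liedtkeKIn N 3 : Set (Fin 3 → F)) ≤ S := by
      refine Subgroup.normalClosure_le_normal ?_
      rintro _ ⟨y, hy, rfl⟩
      refine ⟨fun i => (y i).2, ?_⟩
      have h1 : (commutator N).map N.subtype ≤ R := by
        rw [commutator_def, Subgroup.map_commutator]
        refine Subgroup.commutator_mono ?_ le_top
        rintro _ ⟨z, -, rfl⟩
        exact z.2
      exact h1 ⟨_, mem_liedtkeK.1 hy, rfl⟩
    exact fun hx => hle hx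
  · rintro ⟨hx, hx'⟩
    set L := Subgroup.normalClosure (liedtkeKIn N 3 : Set (Fin 3 → F))
    have hRL : R ≤ L.comap (MonoidHom.mulSingle (fun _ : Fin 3 => F) 0) := by
      refine Subgroup.commutator_le.2 fun n hn f _ => ?_
      have h1 : (![n, n⁻¹, 1] : Fin 3 → F) ∈ L := Subgroup.subset_normalClosure
        (mem_liedtkeKIn_of_mul_eq_one (fun i => by
          fin_cases i
          · exact hn
          · exact inv_mem hn
          · exact one_mem _) (by simp))
      have h2 : MonoidHom.mulSingle (fun _ : Fin 3 => F) 0 ⁅n, f⁆ =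
          ![n, n⁻¹, 1] * (MonoidHom.mulSingle (fun _ : Fin 3 => F) 0 f * ![n, n⁻¹, 1]⁻¹ *
            (MonoidHom.mulSingle (fun _ : Fin 3 => F) 0 f)⁻¹) := by
        funext i
        fin_cases i <;> simp [commutatorElement_def, mul_assoc]
      rw [Subgroup.mem_comap, h2]
      exact mul_mem h1 (Subgroup.normalClosure_normal.conj_mem _ (inv_mem h1) _)
    have h3 : x = MonoidHom.mulSingle (fun _ : Fin 3 => F) 0 (x 0 * x 1 * x 2) *
        ![(x 1 * x 2)⁻¹, x 1, x 2] := by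
      funext i
      fin_cases i <;> simp [mul_assoc]
    rw [h3]
    refine mul_mem (hRL hx') (Subgroup.subset_normalClosure
      (mem_liedtkeKIn_of_mul_eq_one (fun i => ?_) (by simp [mul_assoc])))
    fin_cases i
    · exact inv_mem (mul_mem (hx 1) (hx 2))
    · exact hx 1
    · exact hx 2

/-- The embedding `f ↦ (f, β f, 1)`. -/
def liedtkeLeft (β : F →* F) (hβ : ∀ x, β x * x ∈ commutator F) : F →* liedtkeK F 3 where
  toFun f := ⟨![f, β f, 1], mem_liedtkeK.2 (by simpa using mul_mem_comm_commutator (hβ f))⟩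
  map_one' := Subtype.ext (by funext i; fin_cases i <;> simp)
  map_mul' f g := Subtype.ext (by funext i; fin_cases i <;> simp)

/-- The embedding `f ↦ (f, 1, β f)`. -/
def liedtkeRight (β : F →* F) (hβ : ∀ x, β x * x ∈ commutator F) : F →* liedtkeK F 3 where
  toFun f := ⟨![f, 1, β f], mem_liedtkeK.2 (by simpa using mul_mem_comm_commutator (hβ f))⟩
  map_one' := Subtype.ext (by funext i; fin_cases i <;> simp)
  map_mul' f g := Subtype.ext (by funext i; fin_cases i <;> simp)

theorem comm'_liedtkeLeft_liedtkeRight (β : F →* F) (hβ : ∀ x, β x * x ∈ commutator F) (f g : F) :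
    (comm' (liedtkeLeft β hβ f) (liedtkeRight β hβ g)).1 =
      MonoidHom.mulSingle (fun _ : Fin 3 => F) 0 (comm' f g) := by
  funext i
  fin_cases i <;> simp [comm', liedtkeLeft, liedtkeRight]

end Liedtke

/-! ### The universal property of τ(G) -/

namespace TauPair

variable {G : Type u} [Group G]

/-- The homomorphism from `ν(G)` given by its universal property. -/
def nuLift {T : Type v} [Group T] (P : TauPair G T) : Nu G →* T :=
  QuotientGroup.lift (Subgroup.normalClosure (nuRels G)) (Monoid.Coprod.lift P.X P.Y) (by
    have h : Subgroup.normalClosure (nuRels G) ≤ (Monoid.Coprod.lift P.X P.Y).ker := by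
      refine Subgroup.normalClosure_le_normal ?_
      rintro _ ⟨x, y, z, rfl | rfl⟩
      · simp [MonoidHom.mem_ker, map_conj', map_comm', P.conj_X]
      · simp [MonoidHom.mem_ker, map_conj', map_comm', P.conj_Y]
    exact fun x hx => h hx)

theorem nuLift_inl {T : Type v} [Group T] (P : TauPair G T) (g : G) :
    P.nuLift (Nu.inl G g) = P.X g :=
  Monoid.Coprod.lift_apply_inl P.X P.Y g

theorem nuLift_inr {T : Type v} [Group T] (P : TauPair G T) (g : G) :
    P.nuLift (Nu.inr G g) = P.Y g :=
  Monoid.Coprod.lift_apply_inr P.X P.Y g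

/-- The homomorphism from `τ(G)` given by its universal property. -/
def lift {T : Type v} [Group T] (P : TauPair G T) : Tau G →* T :=
  QuotientGroup.lift (nabla G) P.nuLift (by
    have h : nabla G ≤ P.nuLift.ker := by
      refine (Subgroup.closure_le _).2 ?_
      rintro _ ⟨x, rfl⟩
      refine (map_comm' _ _ _).trans ?_
      rw [nuLift_inl, nuLift_inr]
      exact P.comm_self x
    exact fun x hx => h hx)

variable (G) in
/-- The canonical pair of homomorphisms into `τ(G)`. -/
def universal : TauPair G (Tau G) where
  X := (QuotientGroup.mk' (nabla G)).comp (Nu.inl G)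
  Y := (QuotientGroup.mk' (nabla G)).comp (Nu.inr G)
  conj_X x y z := by
    have := congrArg (QuotientGroup.mk' (nabla G)) (Nu.conj_inl x y z)
    rwa [map_conj', map_comm', map_comm'] at this
  conj_Y x y z := by
    have := congrArg (QuotientGroup.mk' (nabla G)) (Nu.conj_inr x y z)
    rwa [map_conj', map_comm', map_comm'] at this
  comm_self x := by
    refine (map_comm' (QuotientGroup.mk' (nabla G)) _ _).symm.trans ?_
    exact (QuotientGroup.eq_one_iff _).2 (Subgroup.subset_closure ⟨x, rfl⟩)

theorem universal_range_sup : (universal G).X.range ⊔ (universal G).Y.range = ⊤ := by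
  rw [Subgroup.eq_top_iff']
  intro w
  obtain ⟨w, rfl⟩ := QuotientGroup.mk'_surjective _ w
  obtain ⟨w, rfl⟩ := QuotientGroup.mk'_surjective _ w
  induction w using Monoid.Coprod.induction_on with
  | inl z => exact Subgroup.mem_sup_left ⟨z, rfl⟩
  | inr z => exact Subgroup.mem_sup_right ⟨z, rfl⟩
  | mul s t hs ht => rw [map_mul, map_mul]; exact mul_mem hs ht

variable {T : Type v} [Group T] (P : TauPair G T)

@[simp] theorem lift_X (g : G) : P.lift ((universal G).X g) = P.X g :=
  P.nuLift_inl g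

@[simp] theorem lift_Y (g : G) : P.lift ((universal G).Y g) = P.Y g :=
  P.nuLift_inr g

theorem lift_t (x y : G) : P.lift ((universal G).t x y) = P.t x y := by
  rw [t, map_comm', lift_X, lift_Y]; rfl

end TauPair

/-! ### The isomorphism of τ(G) with K̃(G,3) -/

namespace IsExtraSpecial

open scoped commutatorElement

variable {p : ℕ} {G : Type u} [Group G]

theorem nonempty_tau_mulEquiv (hp : p.Prime) (hodd : Odd p) (hG : IsExtraSpecial p G)
    (hcard : Nat.card G = p ^ 3) (hexp : ∀ x : G, x ^ p = 1) {ι : Type w} {π : FreeGroup ι →* G}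
    (hπ : Function.Surjective π) : Nonempty (Tau G ≃* LiedtkeKTilde π 3) := by
  have hc2 := hG.commutator_le_center
  obtain ⟨β, hβ, hβN⟩ := hG.exists_free_inversion hp hodd hcard hexp hπ
  have hRN : ⁅π.ker, (⊤ : Subgroup (FreeGroup ι))⁆ ≤ π.ker := Subgroup.commutator_le_left _ _
  have hβk : ∀ n ∈ π.ker, β n ∈ π.ker := fun n hn => by
    have := mul_mem (hRN (hβN n hn)) (inv_mem hn)
    rwa [mul_inv_cancel_right] at this
  set K := liedtkeK (FreeGroup ι) 3
  set D : Subgroup K := (Subgroup.normalClosure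
    (liedtkeKIn π.ker 3 : Set (Fin 3 → FreeGroup ι))).subgroupOf K with hD
  let q : K →* LiedtkeKTilde π 3 := QuotientGroup.mk' D
  have hq : ∀ {x : K}, q x = 1 ↔ (∀ i, (x : Fin 3 → FreeGroup ι) i ∈ π.ker) ∧
      (x : Fin 3 → FreeGroup ι) 0 * (x : Fin 3 → FreeGroup ι) 1 * (x : Fin 3 → FreeGroup ι) 2 ∈
        ⁅π.ker, (⊤ : Subgroup (FreeGroup ι))⁆ := fun {x} => by
    rw [← mem_normalClosure_liedtkeKIn]
    exact QuotientGroup.eq_one_iff x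
  let Ψ₁ := liedtkeLeft β hβ
  let Ψ₂ := liedtkeRight β hβ
  have hΨ₁ : ∀ n ∈ π.ker, q (Ψ₁ n) = 1 := fun n hn => hq.2 ⟨fun i => by
    fin_cases i
    · exact hn
    · exact hβk n hn
    · exact one_mem _, by
      have h1 := (inferInstance : (⁅π.ker, (⊤ : Subgroup (FreeGroup ι))⁆).Normal).conj_mem _
        (hβN n hn) n
      simpa [Ψ₁, liedtkeLeft, mul_assoc] using h1⟩
  have hΨ₂ : ∀ n ∈ π.ker, q (Ψ₂ n) = 1 := fun n hn => hq.2 ⟨fun i => by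
    fin_cases i
    · exact hn
    · exact one_mem _
    · exact hβk n hn, by
      have h1 := (inferInstance : (⁅π.ker, (⊤ : Subgroup (FreeGroup ι))⁆).Normal).conj_mem _
        (hβN n hn) n
      simpa [Ψ₂, liedtkeRight, mul_assoc] using h1⟩
  let X := π.liftOfRightInverse _ (Function.rightInverse_surjInv hπ)
    ⟨q.comp Ψ₁, fun n hn => hΨ₁ n hn⟩
  let Y := π.liftOfRightInverse _ (Function.rightInverse_surjInv hπ)
    ⟨q.comp Ψ₂, fun n hn => hΨ₂ n hn⟩
  have hX : ∀ f, X (π f) = q (Ψ₁ f) := fun f => MonoidHom.liftOfRightInverse_comp_apply _ _ _ _ f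
  have hY : ∀ f, Y (π f) = q (Ψ₂ f) := fun f => MonoidHom.liftOfRightInverse_comp_apply _ _ _ _ f
  let P : TauPair G (LiedtkeKTilde π 3) :=
    { X := X
      Y := Y
      conj_X := fun x y z => by
        obtain ⟨x, rfl⟩ := hπ x
        obtain ⟨y, rfl⟩ := hπ y
        obtain ⟨z, rfl⟩ := hπ z
        rw [← map_conj', ← map_conj', hX, hY, hX, hX, hY, ← map_comm' q, ← map_conj' q,
          ← map_comm' q]
        refine congrArg q (Subtype.ext (funext fun i => ?_))
        fin_cases i <;> simp [comm', conj', Ψ₁, Ψ₂, liedtkeLeft, liedtkeRight, mul_assoc]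
      conj_Y := fun x y z => by
        obtain ⟨x, rfl⟩ := hπ x
        obtain ⟨y, rfl⟩ := hπ y
        obtain ⟨z, rfl⟩ := hπ z
        rw [← map_conj', ← map_conj', hX, hY, hY, hX, hY, ← map_comm' q, ← map_conj' q,
          ← map_comm' q]
        refine congrArg q (Subtype.ext (funext fun i => ?_))
        fin_cases i <;> simp [comm', conj', Ψ₁, Ψ₂, liedtkeLeft, liedtkeRight, mul_assoc]
      comm_self := fun x => by
        obtain ⟨x, rfl⟩ := hπ x
        rw [hX, hY, ← map_comm' q, ← map_one q]
        refine congrArg q (Subtype.ext (funext fun i => ?_))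
        fin_cases i <;> simp [comm', Ψ₁, Ψ₂, liedtkeLeft, liedtkeRight] }
  have hβG : ∀ x, π (β x) * π x ∈ commutator G := fun x =>
    map_commutator_le π ⟨_, hβ x, map_mul _ _ _⟩
  have hmap : (commutator (FreeGroup ι)).map π = commutator G := by
    rw [commutator_def, commutator_def, Subgroup.map_commutator,
      ← MonoidHom.range_eq_map, MonoidHom.range_eq_top.2 hπ]
  have hπβ : Function.Surjective (π.comp β) := by
    rw [← MonoidHom.range_eq_top]
    refine hG.eq_top_of_forall_mul_center fun x => ?_
    obtain ⟨x, rfl⟩ := hπ x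
    refine ⟨π (β x⁻¹), ⟨x⁻¹, rfl⟩, π (β x) * π x, hc2 (hβG x), ?_⟩
    rw [map_inv, map_inv, inv_mul_cancel_left]
  have hcommutator : ∀ f g, (comm' (Ψ₁ f) (Ψ₂ g)).1 =
      MonoidHom.mulSingle (fun _ : Fin 3 => FreeGroup ι) 0 (comm' f g) :=
    comm'_liedtkeLeft_liedtkeRight β hβ
  have hsurj : Function.Surjective P.lift := by
    have hder : commutator (FreeGroup ι) ≤ ((P.lift.range.comap q).map K.subtype).comap
        (MonoidHom.mulSingle (fun _ : Fin 3 => FreeGroup ι) 0) := by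
      refine Subgroup.commutator_le.2 fun f _ g _ => ?_
      refine ⟨comm' (Ψ₁ f⁻¹) (Ψ₂ g⁻¹), ⟨(TauPair.universal G).t (π f⁻¹) (π g⁻¹), ?_⟩, ?_⟩
      · rw [TauPair.lift_t, TauPair.t, map_comm' q]
        exact congrArg₂ comm' (hX _) (hY _)
      · refine (hcommutator _ _).trans (congrArg _ ?_)
        simp [comm', commutatorElement_def]
    intro y
    obtain ⟨⟨x, hxK⟩, rfl⟩ := QuotientGroup.mk'_surjective D y
    have hx := mem_liedtkeK.1 hxK
    -- `Ψ₁ f₁ * Ψ₂ f₂` matches the last two coordinates of `x` up to `n₁` and `n₂` in the kernel. A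
    -- further factor in the first coordinate, which lies in the commutator subgroup, leaves the
    -- discrepancy `((n₁ * n₂)⁻¹, n₁, n₂)`, of product 1.
    obtain ⟨f₁, hf₁⟩ := hπβ (π (x 1))
    obtain ⟨f₂, hf₂⟩ := hπβ (π (x 2))
    rw [MonoidHom.comp_apply] at hf₁ hf₂
    have hn : ∀ {f g}, π (β f) = π g → (β f)⁻¹ * g ∈ π.ker := fun {f g} h => by
      rw [MonoidHom.mem_ker, map_mul, map_inv, h, inv_mul_cancel]
    set n₁ := (β f₁)⁻¹ * x 1 with hn₁
    set n₂ := (β f₂)⁻¹ * x 2 with hn₂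
    have hd : (f₁ * f₂)⁻¹ * x 0 * n₁ * n₂ ∈ commutator (FreeGroup ι) := by
      have hab : ∀ f, Abelianization.of (β f) = (Abelianization.of f)⁻¹ := fun f => by
        rw [eq_inv_iff_mul_eq_one, ← map_mul, ← MonoidHom.mem_ker, Abelianization.ker_of]
        exact hβ f
      rw [← Abelianization.ker_of, MonoidHom.mem_ker] at hx ⊢
      simp only [hn₁, hn₂, map_mul, map_inv, hab, mul_inv_rev, inv_inv] at hx ⊢
      rw [← hx]
      calc _ = (Abelianization.of f₁ * (Abelianization.of f₁)⁻¹) *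
            (Abelianization.of f₂ * (Abelianization.of f₂)⁻¹) *
            (Abelianization.of (x 0) * Abelianization.of (x 1) * Abelianization.of (x 2)) := by
            ac_rfl
        _ = _ := by rw [mul_inv_cancel, mul_inv_cancel, one_mul, one_mul]
    obtain ⟨z, ⟨w, hw⟩, hz⟩ := hder hd
    refine ⟨(TauPair.universal G).X (π f₁) * (TauPair.universal G).Y (π f₂) * w, ?_⟩
    rw [map_mul, map_mul, TauPair.lift_X, TauPair.lift_Y, hw]
    change X (π f₁) * Y (π f₂) * q z = q ⟨x, hxK⟩
    rw [hX, hY, ← map_mul, ← map_mul, ← inv_mul_eq_one, ← map_inv, ← map_mul, hq]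
    have hz' : ∀ i, (z : Fin 3 → FreeGroup ι) i = MonoidHom.mulSingle
      (fun _ : Fin 3 => FreeGroup ι) 0 ((f₁ * f₂)⁻¹ * x 0 * n₁ * n₂) i := congrFun hz
    have e0 : ((Ψ₁ f₁ * Ψ₂ f₂ * z)⁻¹ * ⟨x, hxK⟩ : K).1 0 = (n₁ * n₂)⁻¹ := by
      simp [hz', Ψ₁, Ψ₂, liedtkeLeft, liedtkeRight, mul_assoc]
    have e1 : ((Ψ₁ f₁ * Ψ₂ f₂ * z)⁻¹ * ⟨x, hxK⟩ : K).1 1 = n₁ := by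
      simp [hz', Ψ₁, Ψ₂, liedtkeLeft, liedtkeRight, hn₁]
    have e2 : ((Ψ₁ f₁ * Ψ₂ f₂ * z)⁻¹ * ⟨x, hxK⟩ : K).1 2 = n₂ := by
      simp [hz', Ψ₁, Ψ₂, liedtkeLeft, liedtkeRight, hn₂]
    refine ⟨fun i => ?_, ?_⟩
    · fin_cases i
      · exact e0 ▸ inv_mem (mul_mem (hn hf₁) (hn hf₂))
      · exact e1 ▸ hn hf₁
      · exact e2 ▸ hn hf₂
    · rw [e0, e1, e2]
      simp [mul_assoc, one_mem]
  -- If `π (β f) = 1`, then `π f` lies in the commutator subgroup, where the map induced by `β` is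
  -- the identity.
  have hπβinj : ∀ f, π (β f) = 1 → π f = 1 := fun f hf => by
    have h1 := hβG f
    rw [hf, one_mul, ← hmap] at h1
    obtain ⟨d, hd, hdf⟩ := h1
    have h2 : π (β d) = π d := eqOn_commutator_of_mul_mem_center hc2 π (π.comp β)
      (fun x => hc2 (hβG x)) hd
    have h3 : π (β (f * d⁻¹)) = 1 := hβk _ (by
      rw [MonoidHom.mem_ker, map_mul, map_inv, hdf, mul_inv_cancel])
    rw [map_mul, map_mul, hf, one_mul, map_inv, map_inv, inv_eq_one, h2, hdf] at h3
    exact h3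
  have hinj : Function.Injective P.lift := by
    obtain ⟨a, b, hab⟩ := hG.not_commute hp
    obtain ⟨a, rfl⟩ := hπ a
    obtain ⟨b, rfl⟩ := hπ b
    set c := comm' a b with hc
    have hcc : π c ∈ Subgroup.center G := by
      rw [hc, map_comm']; exact TauPair.comm'_mem_center hc2 _ _
    have hc1 : π c ≠ 1 := fun h => hab (comm'_eq_one_iff.1 ((map_comm' π a b).symm.trans h))
    have hcz := hG.center_le_zpowers hp hcc hc1
    have hgen := closure_pair_eq_top hp hcard hab
    let U := TauPair.universal G
    have hUt : ∀ x y : G, ∀ {j : ℤ}, (p : ℤ) ∣ j → U.t x y ^ j = 1 := by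
      rintro x y _ ⟨j, rfl⟩
      rw [zpow_mul, zpow_natCast, U.t_pow_eq_one hp hodd hc2 hcz hexp, one_zpow]
    have hlift : ∀ x y, P.lift (U.t (π x) (π y)) = q (comm' (Ψ₁ x) (Ψ₂ y)) := fun x y => by
      rw [TauPair.lift_t, TauPair.t, map_comm' q]
      exact congrArg₂ comm' (hX _) (hY _)
    rw [injective_iff_map_eq_one]
    intro w hw
    obtain ⟨e, he, g, h, rfl⟩ := U.exists_normal_form hc2 hcz hcc hgen
      (TauPair.universal_range_sup (G := G) ▸ Subgroup.mem_top w)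
    obtain ⟨i, j, k, rfl⟩ := U.exists_zpow_of_mem_basicSubgroup hc2 he
    obtain ⟨g, rfl⟩ := hπ g
    obtain ⟨h, rfl⟩ := hπ h
    let ε : ℤ → ℤ → ℤ → FreeGroup ι := fun i j k => comm' a b ^ i * comm' a c ^ j * comm' b c ^ k
    let η : ℤ → ℤ → ℤ → K := fun i j k =>
      comm' (Ψ₁ a) (Ψ₂ b) ^ i * comm' (Ψ₁ a) (Ψ₂ c) ^ j * comm' (Ψ₁ b) (Ψ₂ c) ^ k
    have hη : ∀ i j k, (η i j k : Fin 3 → FreeGroup ι) =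
        MonoidHom.mulSingle (fun _ : Fin 3 => FreeGroup ι) 0 (ε i j k) := fun i j k => by
      simp only [η, ε, Subgroup.coe_mul, Subgroup.coe_zpow, hcommutator, map_mul, map_zpow]
    have hε : ∀ i j k f g, P.lift (U.t (π a) (π b) ^ i * U.t (π a) (π c) ^ j *
        U.t (π b) (π c) ^ k * U.X (π f) * U.Y (π g)) = q (η i j k * Ψ₁ f * Ψ₂ g) :=
      fun i j k f g => by
        simp only [map_mul, map_zpow, hlift, η]
        exact congrArg₂ _ (congrArg₂ _ rfl (hX f)) (hY g)
    rw [hε, hq] at hw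
    have hg : π g = 1 := hπβinj g (by
      simpa [hη, Ψ₁, Ψ₂, liedtkeLeft, liedtkeRight, MonoidHom.mem_ker] using hw.1 1)
    have hh : π h = 1 := hπβinj h (by
      simpa [hη, Ψ₁, Ψ₂, liedtkeLeft, liedtkeRight, MonoidHom.mem_ker] using hw.1 2)
    have hεR : ∀ {i j k}, P.lift (U.t (π a) (π b) ^ i * U.t (π a) (π c) ^ j *
        U.t (π b) (π c) ^ k) = 1 → ε i j k ∈ ⁅π.ker, (⊤ : Subgroup (FreeGroup ι))⁆ :=
      fun {i j k} h => by
        have h1 := hε i j k 1 1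
        rw [map_one π, map_one, map_one, mul_one, mul_one, h, map_one, map_one, mul_one, mul_one,
          eq_comm, hq] at h1
        simpa [hη] using h1.2
    have hw' : P.lift (U.t (π a) (π b) ^ i * U.t (π a) (π c) ^ j * U.t (π b) (π c) ^ k) = 1 := by
      have h1 := hε i j k g h
      rw [hq.2 hw, hg, hh, map_one, map_one, mul_one, mul_one] at h1
      exact h1
    rw [hg, hh, map_one, map_one, mul_one, mul_one]
    have hπc : ∀ x, π (comm' x c) = 1 := fun x => by
      rw [map_comm', comm'_eq_one_iff]; exact Subgroup.mem_center_iff.1 hcc _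
    -- The triple commutators vanish in `G`, where `comm' a b` has order `p`.
    have hi : (p : ℤ) ∣ i := by
      have h1 := hRN (hεR hw')
      have := Fact.mk hp
      simp only [ε, MonoidHom.mem_ker, map_mul, map_zpow, hπc, one_zpow, mul_one] at h1
      rw [← orderOf_dvd_iff_zpow_eq_one, orderOf_eq_prime (hexp _) hc1] at h1
      exact h1
    rw [hUt _ _ hi, one_mul] at hw' ⊢
    have h0 : ε 0 j k ∈ ⁅π.ker, (⊤ : Subgroup (FreeGroup ι))⁆ :=
      hεR (by rwa [zpow_zero, one_mul])
    have hdet : ∀ {Q : Type} [Group Q] (χ : FreeGroup ι →* Q),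
        (∀ n ∈ π.ker, ∀ f, Commute (χ n) (χ f)) →
          χ (comm' a c) ^ j * χ (comm' b c) ^ k = 1 := fun χ hχ => by
      have hle : ⁅π.ker, (⊤ : Subgroup (FreeGroup ι))⁆ ≤ χ.ker :=
        Subgroup.commutator_le.2 fun n hn f _ => by
          rw [MonoidHom.mem_ker, map_commutatorElement, commutatorElement_eq_one_iff_commute]
          exact hχ n hn f
      simpa [ε] using hle h0
    -- The pair `(a, b)` kills the commutator of `a` with `c` and detects `k`; the swapped pair
    -- detects `j`.
    obtain ⟨Q, _, χ, hχ, hχ1, hχ2⟩ := hG.exists_hom_detecting hp hodd hcard hexp π hab hcc hc1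
    obtain ⟨Q', _, χ', hχ', hχ1', hχ2'⟩ := hG.exists_hom_detecting hp hodd hcard hexp π
      (fun h => hab h.symm) hcc hc1
    have hk : (p : ℤ) ∣ k := hχ2 k (by simpa [hχ1] using hdet χ hχ)
    have hj : (p : ℤ) ∣ j := hχ2' j (by simpa [hχ1'] using hdet χ' hχ')
    rw [hUt _ _ hj, hUt _ _ hk, one_mul]
  exact ⟨MulEquiv.ofBijective P.lift ⟨hinj, hsurj⟩⟩

end IsExtraSpecial

/-! ### Assembly of the proposition -/

theorem mainTheorem8 (p : ℕ) (hp : p.Prime) (hodd : Odd p)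
    (G : Type u) [Group G] [Finite G] (hG : IsExtraSpecial p G) :
    (Monoid.exponent G = p →
      (Nat.card G = p ^ 3 →
        ∀ (ι : Type w) [Finite ι] (π : FreeGroup ι →* G), Function.Surjective π →
          Nonempty (Tau G ≃* LiedtkeKTilde π 3)) ∧
      ∀ n : ℕ, 2 ≤ n → Nat.card G = p ^ (2 * n + 1) →
        (∃ (H : Type u) (_ : Group H) (π : H →* G), IsSchurCover π ∧ ∃ α : H ≃* H, IsAI α) ∧
        ∀ (H : Type v) [Group H] (π : H →* G), IsSchurCover π →
          ∀ α : H ≃* H, IsAI α → ¬ ∀ m ∈ π.ker, α m = m⁻¹) ∧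
    (Monoid.exponent G = p ^ 2 → ¬ ∃ α : G ≃* G, IsAI α) := by
  refine ⟨fun hexp => ?_, ?_⟩
  · have hpow : ∀ x : G, x ^ p = 1 := fun x => hexp ▸ Monoid.pow_exponent_eq_one x
    refine ⟨fun hcard ι _ π hπ => hG.nonempty_tau_mulEquiv hp hodd hcard hpow hπ,
      fun n hn hcard => ?_⟩
    have hlt : p ^ 3 < Nat.card G := hcard ▸ Nat.pow_lt_pow_right hp.one_lt (by omega)
    exact ⟨hG.exists_isSchurCover_isAI hp hodd hlt hpow,
      fun H _ π hπ α hα => hG.not_forall_inv_of_isSchurCover hp hodd hlt hpow hπ hα⟩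
  · rintro hexp ⟨α, hα⟩
    have h := Monoid.exponent_dvd_of_forall_pow_eq_one (hG.pow_eq_one_of_isAI hodd hα)
    rw [hexp] at h
    have h1 := Nat.le_of_dvd hp.pos h
    nlinarith [hp.one_lt]
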